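/- **Theorem (Radon–Nikodym, discrete case).** Let $\mathbb K$ be $\mathbb R$ or $\mathbb C$. A *Banach category* is a category enriched in Banach spaces and linear contractions (with the projective tensor product): its hom-sets are Banach spaces, composition is bilinear with $\|gf\|\le\|g\|\|f\|$, and $\|\mathrm{id}\|\le 1$. A functor between Banach categories is *contractive* if it is a linear contraction on hom-spaces; a functor from an ordinary category into a Banach category is *contractive* if all its values on morphisms have norm $\le 1$. Functor categories carry the uniformly bounded natural transformations with the supremum norm, and so are Banach categories. $\mathrm{Ban}$ is the Banach category of Banach spaces and bounded linear maps. A *Banach 2-space* is a cocomplete Banach category (all small weighted colimits exist, in the enriched, isometric sense), and a contractive functor is *cocontinuous* if it preserves all small weighted colimits. The tensor $V\otimes a$ of a Banach space $V$ and an object $a$ is the object representing $b\mapsto \mathrm{Ban}(V,\mathcal A(a,b))$ isometrically, and a coproduct $\sum_i a_i$ is an object representing isometrically the uniformly bounded families in $\prod_i\mathcal A(a_i,b)$. Let $X$ be a countable set, regarded also as a discrete category, and let $\mathcal A$ be a Banach 2-space. A *cosheaf* $\mu\colon\mathcal P(X)\to\mathcal A$ is a contractive functor on the poset $\mathcal P(X)$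 of subsets of $X$ that is $\sigma$-additive: for every $E\subseteq X$ and every countable partition $\mathcal E$ of $E$ into non-empty sets, the induced map $\sum_{F\in\mathcal E}\mu(F)\to\mu(E)$ is an isometric isomorphism (for $E=\emptyset$ the empty partition is allowed). Write $\mu(x)=\mu(\{x\})$. Let $\mathrm{PShv}(X)$ be the Banach category of functors $X^{\mathrm{op}}\to\mathrm{Ban}$ and $\mathrm{Bundle}(X)$ that of families $(\xi_x)_{x\in X}$ of Banach spaces, with uniformly bounded families of bounded linear maps as morphisms. For $E\subseteq X$ let $\chi(E)$ be the characteristic bundle of $E$, with fiber $\mathbb K$ over the points of $E$ and $0$ elsewhere; it is a functor of $E$ through the inclusions of fibers, and $\chi(\{x\})=\delta_x$. 1. The restriction functor $\mu\mapsto(x\mapsto\mu(x))$ from cosheaves $\mathcal P(X)\to\mathcal A$ to contractive functors $X\to\mathcal A$ is an equivalence of Banach categories: it is linear and isometric and bijective on hom-spaces, and moreover it is surjective on objects. (Hence every contractive functor $X\to\mathcal A$ is the restriction of a cosheaf, which is unique up to a unique isometric isomorphism restricting to the identity.) 2. The functor $\xi\mapsto(x\mapsto\xi_x)$ is an isomorphism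 of Banach categories $\mathrm{Bundle}(X)\cong\mathrm{PShv}(X)$: it is bijective on objects and an isometric linear isomorphism on hom-spaces. Moreover $\mathrm{PShv}(X)$ is a Banach 2-space. 3. $\chi\colon\mathcal P(X)\to\mathrm{PShv}(X)$ is a cosheaf; for every cocontinuous $T\colon\mathrm{PShv}(X)\to\mathcal A$ the composite $T\chi$ is a cosheaf, and $T\mapsto T\chi$ is an equivalence of Banach categories from the cocontinuous functors $\mathrm{PShv}(X)\to\mathcal A$ to the cosheaves $\mathcal P(X)\to\mathcal A$ (isometrically fully faithful, and essentially surjective up to isometric isomorphism). 4. For every cosheaf $\mu\colon\mathcal P(X)\to\mathcal A$ there is a left Kan extension $\int\mathrm d\mu\colon\mathrm{PShv}(X)\to\mathcal A$ of $\mu$ along $\chi$ (in the enriched sense, among contractive functors), its unit $\mu\to(\int\mathrm d\mu)\chi$ is an isometric isomorphism, $\int\mathrm d\mu$ is cocontinuous, and there are isometric isomorphisms, natural in $\xi$, $$\int_X\xi\,\mathrm d\mu\;\cong\;\sum_{x\in X}\xi_x\otimes\mu(x).$$ -/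

import Mathlib

open CategoryTheory Opposite
open scoped ENNReal

universe u v w v₁ w₁ v₂ w₂

attribute [local instance 2000] CategoryTheory.CategoryStruct.toQuiver

noncomputable section

/-! ### Banach categories -/

/-- The hom-sets of `C` are normed groups. -/
class HomNormed (C : Type v) [Category.{w} C] where
  homGroup : ∀ a b : C, NormedAddCommGroup (a ⟶ b)

attribute [reducible, instance] HomNormed.homGroup

/-- A Banach category over `𝕜`: a category enriched in Banach spaces and linear contractions
(with the projective tensor product). Explicitly, every hom-set is a Banach space, composition is
bilinear and contractive, and identities have norm at most one. -/
class BanachCategory (𝕜 : Type) [RCLike 𝕜] (C : Type v) [Category.{w} C] [HomNormed C] where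
  homSpace : ∀ a b : C, NormedSpace 𝕜 (a ⟶ b)
  homComplete : ∀ a b : C, CompleteSpace (a ⟶ b)
  add_comp : ∀ {a b c : C} (f f' : a ⟶ b) (g : b ⟶ c), (f + f') ≫ g = f ≫ g + f' ≫ g
  comp_add : ∀ {a b c : C} (f : a ⟶ b) (g g' : b ⟶ c), f ≫ (g + g') = f ≫ g + f ≫ g'
  smul_comp : ∀ {a b c : C} (r : 𝕜) (f : a ⟶ b) (g : b ⟶ c), (r • f) ≫ g = r • (f ≫ g)
  comp_smul : ∀ {a b c : C} (r : 𝕜) (f : a ⟶ b) (g : b ⟶ c), f ≫ (r • g) = r • (f ≫ g)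
  norm_comp_le : ∀ {a b c : C} (f : a ⟶ b) (g : b ⟶ c), ‖f ≫ g‖ ≤ ‖f‖ * ‖g‖
  norm_id_le : ∀ a : C, ‖𝟙 a‖ ≤ 1

attribute [reducible, instance] BanachCategory.homSpace
attribute [instance] BanachCategory.homComplete

/-- A contractive (that is, enriched) functor between Banach categories: its action on morphisms
is a linear contraction. -/
structure IsBanachFunctor (𝕜 : Type) [RCLike 𝕜]
    {B : Type v₁} [Category.{w₁} B] [HomNormed B] [BanachCategory 𝕜 B]
    {A : Type v₂} [Category.{w₂} A] [HomNormed A] [BanachCategory 𝕜 A] (T : B ⥤ A) : Prop where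
  map_add : ∀ {a b : B} (f g : a ⟶ b), T.map (f + g) = T.map f + T.map g
  map_smul : ∀ {a b : B} (r : 𝕜) (f : a ⟶ b), T.map (r • f) = r • T.map f
  norm_map_le : ∀ {a b : B} (f : a ⟶ b), ‖T.map f‖ ≤ ‖f‖

/-- A contractive functor from an ordinary category into a Banach category: a functor with values
in the contractions. It is the same thing as a contractive functor on the free Banach category
on `J`, whose hom-spaces are the spaces `ℓ¹(J(i, j))`. -/
def IsContractive {J : Type v₁} [Category.{w₁} J] {A : Type v₂} [Category.{w₂} A] [HomNormed A]
    (F : J ⥤ A) : Prop :=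
  ∀ ⦃i j : J⦄ (f : i ⟶ j), ‖F.map f‖ ≤ 1

/-! ### The Banach category of Banach spaces -/

/-- Banach spaces over `𝕜`. -/
structure Ban (𝕜 : Type) [RCLike 𝕜] : Type (u + 1) where
  carrier : Type u
  [group : NormedAddCommGroup carrier]
  [space : NormedSpace 𝕜 carrier]
  [complete : CompleteSpace carrier]

attribute [instance] Ban.group Ban.space Ban.complete

namespace Ban

variable {𝕜 : Type} [RCLike 𝕜]

instance : CoeSort (Ban.{u} 𝕜) (Type u) := ⟨Ban.carrier⟩

/-- Morphisms are the bounded linear maps. -/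
instance : Category.{u} (Ban.{u} 𝕜) where
  Hom V W := V →L[𝕜] W
  id V := ContinuousLinearMap.id 𝕜 V
  comp f g := ContinuousLinearMap.comp g f

instance : HomNormed (Ban.{u} 𝕜) where
  homGroup V W := inferInstanceAs (NormedAddCommGroup (V →L[𝕜] W))

/-- The bounded linear map underlying a morphism. -/
def toCLM {V W : Ban.{u} 𝕜} (f : V ⟶ W) : V →L[𝕜] W := f

instance : BanachCategory 𝕜 (Ban.{u} 𝕜) where
  homSpace V W := inferInstanceAs (NormedSpace 𝕜 (V →L[𝕜] W))
  homComplete V W := inferInstanceAs (CompleteSpace (V →L[𝕜] W))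
  add_comp f f' g := ContinuousLinearMap.comp_add g f f'
  comp_add f g g' := ContinuousLinearMap.add_comp g g' f
  smul_comp r f g := ContinuousLinearMap.comp_smul g r f
  comp_smul r f g := ContinuousLinearMap.smul_comp r g f
  norm_comp_le f g := (ContinuousLinearMap.opNorm_comp_le g f).trans_eq (mul_comm _ _)
  norm_id_le _ := ContinuousLinearMap.norm_id_le

end Ban

/-! ### Colimits in Banach categories -/

/-- `t`, with `u : V → A(a, t)`, is the tensor `V ⊗ a`: composition with `u` is an isometric
isomorphism `A(t, b) ≅ Ban(V, A(a, b))` for every `b`. -/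
structure IsTensor {𝕜 : Type} [RCLike 𝕜] {A : Type v} [Category.{w} A] [HomNormed A]
    [BanachCategory 𝕜 A] (V : Ban.{u} 𝕜) (a t : A) (ten : V →L[𝕜] (a ⟶ t)) : Prop where
  norm_le : ‖ten‖ ≤ 1
  desc : ∀ (b : A) (φ : V →L[𝕜] (a ⟶ b)), ∃ h : t ⟶ b, ‖h‖ ≤ ‖φ‖ ∧ ∀ s, ten s ≫ h = φ s
  uniq : ∀ (b : A) (h h' : t ⟶ b), (∀ s, ten s ≫ h = ten s ≫ h') → h = h'

/-- `c`, with the injections `inj j : a j ⟶ c`, is the coproduct of the family `a`: composition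
with the injections is an isometric isomorphism from `A(c, b)` onto the Banach space of uniformly
bounded families in `∏ j, A(a j, b)`, for every `b`. -/
structure IsCoproduct {A : Type v} [Category.{w} A] [HomNormed A] {ι : Type v₁}
    (a : ι → A) (c : A) (inj : ∀ j, a j ⟶ c) : Prop where
  norm_le : ∀ j, ‖inj j‖ ≤ 1
  desc : ∀ (b : A) (f : ∀ j, a j ⟶ b) (C : ℝ), 0 ≤ C → (∀ j, ‖f j‖ ≤ C) →
    ∃ h : c ⟶ b, ‖h‖ ≤ C ∧ ∀ j, inj j ≫ h = f j
  uniq : ∀ (b : A) (h h' : c ⟶ b), (∀ j, inj j ≫ h = inj j ≫ h') → h = h'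

/-- A contractive (enriched) functor `W : Jᵒᵖ → Ban` on the dual of a Banach category. -/
structure IsWeight {𝕜 : Type} [RCLike 𝕜] {J : Type u} [Category.{u} J] [HomNormed J]
    [BanachCategory 𝕜 J] (W : Jᵒᵖ ⥤ Ban.{u} 𝕜) : Prop where
  map_add : ∀ {i j : J} (f g : i ⟶ j), W.map (f + g).op = W.map f.op + W.map g.op
  map_smul : ∀ {i j : J} (r : 𝕜) (f : i ⟶ j), W.map (r • f).op = r • W.map f.op
  norm_map_le : ∀ {i j : J} (f : i ⟶ j), ‖W.map f.op‖ ≤ ‖f‖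

/-- The family `φ` is a natural transformation `W → A(D -, c)` of norm at most `C`. -/
structure IsCocone {𝕜 : Type} [RCLike 𝕜] {J : Type u} [Category.{u} J]
    {A : Type v} [Category.{u} A] [HomNormed A] [BanachCategory 𝕜 A]
    (W : Jᵒᵖ ⥤ Ban.{u} 𝕜) (D : J ⥤ A) (c : A) (C : ℝ)
    (φ : ∀ j, W.obj (op j) → (D.obj j ⟶ c)) : Prop where
  map_add : ∀ j s t, φ j (s + t) = φ j s + φ j t
  map_smul : ∀ j (r : 𝕜) s, φ j (r • s) = r • φ j s
  norm_le : ∀ j s, ‖φ j s‖ ≤ C * ‖s‖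
  natural : ∀ {i j : J} (f : i ⟶ j) (s : W.obj (op j)),
    φ i (Ban.toCLM (W.map f.op) s) = D.map f ≫ φ j s

/-- `c`, with the cocone `inj`, is the colimit of `D` weighted by `W`: composition with `inj` is an
isometric isomorphism `A(c, b) ≅ [Jᵒᵖ, Ban](W, A(D -, b))` for every `b`. -/
structure IsWeightedColimit {𝕜 : Type} [RCLike 𝕜] {J : Type u} [Category.{u} J]
    {A : Type v} [Category.{u} A] [HomNormed A] [BanachCategory 𝕜 A]
    (W : Jᵒᵖ ⥤ Ban.{u} 𝕜) (D : J ⥤ A) (c : A)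
    (inj : ∀ j, W.obj (op j) → (D.obj j ⟶ c)) : Prop where
  isCocone : IsCocone W D c 1 inj
  desc : ∀ (b : A) (φ : ∀ j, W.obj (op j) → (D.obj j ⟶ b)) (C : ℝ), 0 ≤ C →
    IsCocone W D b C φ → ∃ h : c ⟶ b, ‖h‖ ≤ C ∧ ∀ j s, inj j s ≫ h = φ j s
  uniq : ∀ (b : A) (h h' : c ⟶ b), (∀ j s, inj j s ≫ h = inj j s ≫ h') → h = h'

/-- A Banach 2-space: a cocomplete Banach category, that is, one with all colimits of contractive
functors on small Banach categories `J`, weighted by contractive functors `Jᵒᵖ → Ban`. -/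
def IsBanachTwoSpace (𝕜 : Type) [RCLike 𝕜] (A : Type v) [Category.{u} A] [HomNormed A]
    [BanachCategory 𝕜 A] : Prop :=
  ∀ (J : Type u) [Category.{u} J] [HomNormed J] [BanachCategory 𝕜 J]
    (W : Jᵒᵖ ⥤ Ban.{u} 𝕜) (D : J ⥤ A), IsWeight W → IsBanachFunctor 𝕜 D →
    ∃ (c : A) (inj : ∀ j, W.obj (op j) → (D.obj j ⟶ c)), IsWeightedColimit W D c inj

/-- A functor is cocontinuous if it is contractive and preserves all small weighted colimits. -/
structure IsCocontinuous (𝕜 : Type) [RCLike 𝕜]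
    {B : Type v₁} [Category.{u} B] [HomNormed B] [BanachCategory 𝕜 B]
    {A : Type v₂} [Category.{u} A] [HomNormed A] [BanachCategory 𝕜 A] (T : B ⥤ A) : Prop where
  isBanachFunctor : IsBanachFunctor 𝕜 T
  preserves : ∀ (J : Type u) [Category.{u} J] [HomNormed J] [BanachCategory 𝕜 J]
    (W : Jᵒᵖ ⥤ Ban.{u} 𝕜) (D : J ⥤ B), IsWeight W → IsBanachFunctor 𝕜 D →
    ∀ (c : B) (inj : ∀ j, W.obj (op j) → (D.obj j ⟶ c)), IsWeightedColimit W D c inj →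
      IsWeightedColimit W (D ⋙ T) (T.obj c) (fun j s => T.map (inj j s))

/-! ### Banach categories of functors -/

section FunCat

variable (𝕜 : Type) [RCLike 𝕜]
variable {C : Type v} [Category.{w} C] {A : Type v₁} [Category.{w₁} A] [HomNormed A]
  [BanachCategory 𝕜 A]

/-- The uniformly bounded natural transformations `F → G`, as a subspace of the space of uniformly
bounded families with the supremum norm. -/
def boundedNat (F G : C ⥤ A) : Submodule 𝕜 (lp (fun a : C => F.obj a ⟶ G.obj a) ∞) where
  carrier := {τ | ∀ ⦃a b : C⦄ (f : a ⟶ b), F.map f ≫ τ b = τ a ≫ G.map f}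
  zero_mem' a b f := by
    have h1 := BanachCategory.comp_smul (0 : 𝕜) (F.map f) (0 : F.obj b ⟶ G.obj b)
    have h2 := BanachCategory.smul_comp (0 : 𝕜) (0 : F.obj a ⟶ G.obj a) (G.map f)
    simp only [zero_smul] at h1 h2
    exact h1.trans h2.symm
  add_mem' {σ τ} hσ hτ a b f := by
    have h1 := BanachCategory.comp_add (𝕜 := 𝕜) (F.map f) (σ b) (τ b)
    have h2 := BanachCategory.add_comp (𝕜 := 𝕜) (σ a) (τ a) (G.map f)
    rw [hσ f, hτ f] at h1
    exact h1.trans h2.symm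
  smul_mem' r τ hτ a b f := by
    have h1 := BanachCategory.comp_smul r (F.map f) (τ b)
    have h2 := BanachCategory.smul_comp r (τ a) (G.map f)
    rw [hτ f] at h1
    exact h1.trans h2.symm

theorem isClosed_boundedNat (F G : C ⥤ A) :
    IsClosed (boundedNat 𝕜 F G : Set (lp (fun a : C => F.obj a ⟶ G.obj a) ∞)) := by
  have h : (boundedNat 𝕜 F G : Set (lp (fun a : C => F.obj a ⟶ G.obj a) ∞)) =
      ⋂ (a : C) (b : C) (f : a ⟶ b), {τ | F.map f ≫ τ b = τ a ≫ G.map f} := by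
    ext τ
    simp only [Set.mem_iInter, Set.mem_ofPred_eq]
    rfl
  rw [h]
  refine isClosed_iInter fun a => isClosed_iInter fun b => isClosed_iInter fun f => ?_
  have hev : ∀ c : C, Continuous
      (fun τ : lp (fun a : C => F.obj a ⟶ G.obj a) ∞ => τ c) := fun c =>
    (lp.lipschitzWith_one_eval ∞ c).continuous
  have hl : Continuous (fun g : F.obj b ⟶ G.obj b => F.map f ≫ g) :=
    AddMonoidHomClass.continuous_of_bound
      (AddMonoidHom.mk' (fun g : F.obj b ⟶ G.obj b => F.map f ≫ g)
        (BanachCategory.comp_add (𝕜 := 𝕜) (F.map f))) ‖F.map f‖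
      (fun g => BanachCategory.norm_comp_le (𝕜 := 𝕜) (F.map f) g)
  have hr : Continuous (fun g : F.obj a ⟶ G.obj a => g ≫ G.map f) :=
    AddMonoidHomClass.continuous_of_bound
      (AddMonoidHom.mk' (fun g : F.obj a ⟶ G.obj a => g ≫ G.map f)
        (fun g g' => BanachCategory.add_comp (𝕜 := 𝕜) g g' (G.map f))) ‖G.map f‖
      (fun g => (BanachCategory.norm_comp_le (𝕜 := 𝕜) g (G.map f)).trans_eq (mul_comm _ _))
  exact isClosed_eq (hl.comp (hev b)) (hr.comp (hev a))

end FunCat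

/-- The functors `C ⥤ A` with the property `P`. -/
structure FunCat (𝕜 : Type) [RCLike 𝕜] {C : Type v} [Category.{w} C] {A : Type v₁}
    [Category.{w₁} A] [HomNormed A] [BanachCategory 𝕜 A] (P : (C ⥤ A) → Prop) where
  obj : C ⥤ A
  property : P obj

namespace FunCat

variable {𝕜 : Type} [RCLike 𝕜]
variable {C : Type v} [Category.{w} C] {A : Type v₁} [Category.{w₁} A] [HomNormed A]
  [BanachCategory 𝕜 A] {P : (C ⥤ A) → Prop}

/-- A family of morphisms, bounded by `K` and natural, as a bounded natural transformation. -/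
def mkNat {F G : C ⥤ A} (τ : ∀ a, F.obj a ⟶ G.obj a) (K : ℝ) (hK : ∀ a, ‖τ a‖ ≤ K)
    (hn : ∀ ⦃a b : C⦄ (f : a ⟶ b), F.map f ≫ τ b = τ a ≫ G.map f) : boundedNat 𝕜 F G :=
  ⟨⟨τ, memℓp_infty ⟨K, by rintro _ ⟨a, rfl⟩; exact hK a⟩⟩, hn⟩

/-- Morphisms are the uniformly bounded natural transformations, with the supremum norm. -/
instance : Category.{max v w₁} (FunCat 𝕜 P) where
  Hom F G := boundedNat 𝕜 F.obj G.obj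
  id F := mkNat (fun a => 𝟙 (F.obj.obj a)) 1
    (fun a => BanachCategory.norm_id_le (𝕜 := 𝕜) (F.obj.obj a)) (fun a b f => by simp)
  comp σ τ := mkNat (fun a => σ.1 a ≫ τ.1 a) (‖σ‖ * ‖τ‖)
    (fun a => (BanachCategory.norm_comp_le (𝕜 := 𝕜) (σ.1 a) (τ.1 a)).trans
      (mul_le_mul (lp.norm_apply_le_norm ENNReal.top_ne_zero σ.1 a)
        (lp.norm_apply_le_norm ENNReal.top_ne_zero τ.1 a) (norm_nonneg _) (norm_nonneg _)))
    (fun a b f => by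
      rw [← Category.assoc, σ.2 f, Category.assoc, τ.2 f, Category.assoc])
  id_comp σ := Subtype.ext (lp.ext (funext fun a => Category.id_comp (σ.1 a)))
  comp_id σ := Subtype.ext (lp.ext (funext fun a => Category.comp_id (σ.1 a)))
  assoc σ τ ρ := Subtype.ext (lp.ext (funext fun a => Category.assoc (σ.1 a) (τ.1 a) (ρ.1 a)))

instance : HomNormed (FunCat 𝕜 P) where
  homGroup F G := inferInstanceAs (NormedAddCommGroup (boundedNat 𝕜 F.obj G.obj))

/-- The component of a bounded natural transformation at an object. -/
def app {F G : FunCat 𝕜 P} (τ : F ⟶ G) (a : C) : F.obj.obj a ⟶ G.obj.obj a :=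
  (show boundedNat 𝕜 F.obj G.obj from τ).1 a

instance : BanachCategory 𝕜 (FunCat 𝕜 P) where
  homSpace F G := inferInstanceAs (NormedSpace 𝕜 (boundedNat 𝕜 F.obj G.obj))
  homComplete F G := (isClosed_boundedNat 𝕜 F.obj G.obj).completeSpace_coe
  add_comp σ σ' τ := Subtype.ext (lp.ext (funext fun a =>
    BanachCategory.add_comp (𝕜 := 𝕜) (app σ a) (app σ' a) (app τ a)))
  comp_add σ τ τ' := Subtype.ext (lp.ext (funext fun a =>
    BanachCategory.comp_add (𝕜 := 𝕜) (app σ a) (app τ a) (app τ' a)))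
  smul_comp r σ τ := Subtype.ext (lp.ext (funext fun a =>
    BanachCategory.smul_comp r (app σ a) (app τ a)))
  comp_smul r σ τ := Subtype.ext (lp.ext (funext fun a =>
    BanachCategory.comp_smul r (app σ a) (app τ a)))
  norm_comp_le σ τ := lp.norm_le_of_forall_le
    (mul_nonneg (norm_nonneg σ) (norm_nonneg τ)) (fun a =>
      (BanachCategory.norm_comp_le (𝕜 := 𝕜) (app σ a) (app τ a)).trans
        (mul_le_mul (lp.norm_apply_le_norm ENNReal.top_ne_zero σ.1 a)
          (lp.norm_apply_le_norm ENNReal.top_ne_zero τ.1 a) (norm_nonneg _) (norm_nonneg _)))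
  norm_id_le F := lp.norm_le_of_forall_le zero_le_one (fun a =>
    BanachCategory.norm_id_le (𝕜 := 𝕜) (F.obj.obj a))

/-- Precomposition with a functor `K`, as a functor between Banach categories of functors. -/
def precomp {C' : Type v₂} [Category.{w₂} C'] {Q : (C' ⥤ A) → Prop} (K : C' ⥤ C)
    (h : ∀ F : C ⥤ A, P F → Q (K ⋙ F)) : FunCat 𝕜 P ⥤ FunCat 𝕜 Q where
  obj F := ⟨K ⋙ F.obj, h F.obj F.property⟩
  map {F G} τ := mkNat (fun c => app τ (K.obj c)) ‖τ‖
    (fun c => lp.norm_apply_le_norm ENNReal.top_ne_zero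
      (show boundedNat 𝕜 F.obj G.obj from τ).1 (K.obj c))
    (fun _ _ f => (show boundedNat 𝕜 F.obj G.obj from τ).2 (K.map f))

end FunCat

/-! ### Bundles and presheaves -/

/-- Bundles of Banach spaces over the set `X`. -/
structure Bundle (𝕜 : Type) [RCLike 𝕜] (X : Type u) : Type (u + 1) where
  fiber : X → Ban.{u} 𝕜

namespace Bundle

variable {𝕜 : Type} [RCLike 𝕜] {X : Type u}

/-- A uniformly bounded family of bounded linear maps between the fibers. -/
def mkHom {ξ ζ : Bundle 𝕜 X} (τ : ∀ x, ξ.fiber x ⟶ ζ.fiber x) (K : ℝ) (hK : ∀ x, ‖τ x‖ ≤ K) :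
    lp (fun x => ξ.fiber x ⟶ ζ.fiber x) ∞ :=
  ⟨τ, memℓp_infty ⟨K, by rintro _ ⟨x, rfl⟩; exact hK x⟩⟩

/-- Morphisms are the uniformly bounded families of bounded linear maps between the fibers, with
the supremum norm. -/
instance : Category.{u} (Bundle.{u} 𝕜 X) where
  Hom ξ ζ := lp (fun x => ξ.fiber x ⟶ ζ.fiber x) ∞
  id ξ := mkHom (fun x => 𝟙 (ξ.fiber x)) 1
    (fun x => BanachCategory.norm_id_le (𝕜 := 𝕜) (ξ.fiber x))
  comp σ τ := mkHom (fun x => σ x ≫ τ x) (‖σ‖ * ‖τ‖)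
    (fun x => (BanachCategory.norm_comp_le (𝕜 := 𝕜) (σ x) (τ x)).trans
      (mul_le_mul (lp.norm_apply_le_norm ENNReal.top_ne_zero σ x)
        (lp.norm_apply_le_norm ENNReal.top_ne_zero τ x) (norm_nonneg _) (norm_nonneg _)))
  id_comp σ := lp.ext (funext fun x => Category.id_comp (σ x))
  comp_id σ := lp.ext (funext fun x => Category.comp_id (σ x))
  assoc σ τ ρ := lp.ext (funext fun x => Category.assoc (σ x) (τ x) (ρ x))

instance : HomNormed (Bundle.{u} 𝕜 X) where
  homGroup ξ ζ := inferInstanceAs (NormedAddCommGroup (lp (fun x => ξ.fiber x ⟶ ζ.fiber x) ∞))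

/-- The component of a morphism of bundles at a point. -/
def app {ξ ζ : Bundle.{u} 𝕜 X} (τ : ξ ⟶ ζ) (x : X) : ξ.fiber x ⟶ ζ.fiber x :=
  (show lp (fun x => ξ.fiber x ⟶ ζ.fiber x) ∞ from τ) x

instance : BanachCategory 𝕜 (Bundle.{u} 𝕜 X) where
  homSpace ξ ζ := inferInstanceAs (NormedSpace 𝕜 (lp (fun x => ξ.fiber x ⟶ ζ.fiber x) ∞))
  homComplete ξ ζ := inferInstanceAs (CompleteSpace (lp (fun x => ξ.fiber x ⟶ ζ.fiber x) ∞))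
  add_comp σ σ' τ := lp.ext (funext fun x =>
    BanachCategory.add_comp (𝕜 := 𝕜) (app σ x) (app σ' x) (app τ x))
  comp_add σ τ τ' := lp.ext (funext fun x =>
    BanachCategory.comp_add (𝕜 := 𝕜) (app σ x) (app τ x) (app τ' x))
  smul_comp r σ τ := lp.ext (funext fun x =>
    BanachCategory.smul_comp r (app σ x) (app τ x))
  comp_smul r σ τ := lp.ext (funext fun x =>
    BanachCategory.comp_smul r (app σ x) (app τ x))
  norm_comp_le σ τ := lp.norm_le_of_forall_le
    (mul_nonneg (norm_nonneg σ) (norm_nonneg τ)) (fun x =>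
      (BanachCategory.norm_comp_le (𝕜 := 𝕜) (app σ x) (app τ x)).trans
        (mul_le_mul (lp.norm_apply_le_norm ENNReal.top_ne_zero σ x)
          (lp.norm_apply_le_norm ENNReal.top_ne_zero τ x) (norm_nonneg _) (norm_nonneg _)))
  norm_id_le ξ := lp.norm_le_of_forall_le zero_le_one (fun x =>
    BanachCategory.norm_id_le (𝕜 := 𝕜) (ξ.fiber x))

end Bundle

/-- Contractive functors from an ordinary category `J` to a Banach category, with uniformly bounded
natural transformations. -/
abbrev ContractiveFun (𝕜 : Type) [RCLike 𝕜] (J : Type v) [Category.{w} J] (A : Type v₁)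
    [Category.{w₁} A] [HomNormed A] [BanachCategory 𝕜 A] :=
  FunCat 𝕜 (fun F : J ⥤ A => IsContractive F)

/-- Contractive functors between Banach categories, with uniformly bounded natural
transformations. -/
abbrev BanachFun (𝕜 : Type) [RCLike 𝕜] (B : Type v) [Category.{w} B] [HomNormed B]
    [BanachCategory 𝕜 B] (A : Type v₁) [Category.{w₁} A] [HomNormed A] [BanachCategory 𝕜 A] :=
  FunCat 𝕜 (fun T : B ⥤ A => IsBanachFunctor 𝕜 T)

/-- Cocontinuous functors between Banach categories, with uniformly bounded natural
transformations. -/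
abbrev CocontinuousFun (𝕜 : Type) [RCLike 𝕜] (B : Type v) [Category.{u} B] [HomNormed B]
    [BanachCategory 𝕜 B] (A : Type v₁) [Category.{u} A] [HomNormed A] [BanachCategory 𝕜 A] :=
  FunCat 𝕜 (fun T : B ⥤ A => IsCocontinuous 𝕜 T)

/-- The presheaves of Banach spaces on the set `X`, regarded as a discrete category. -/
abbrev PShv (𝕜 : Type) [RCLike 𝕜] (X : Type u) :=
  ContractiveFun 𝕜 (Discrete X)ᵒᵖ (Ban.{u} 𝕜)

theorem isContractive_of_discrete_op (𝕜 : Type) [RCLike 𝕜] {X : Type u} {A : Type v}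
    [Category.{w} A] [HomNormed A] [BanachCategory 𝕜 A] (F : (Discrete X)ᵒᵖ ⥤ A) :
    IsContractive F := by
  rintro ⟨⟨x⟩⟩ ⟨⟨y⟩⟩ f
  obtain rfl : y = x := Discrete.eq_of_hom f.unop
  rw [show f = 𝟙 _ from Quiver.Hom.unop_inj (Subsingleton.elim _ _), F.map_id]
  exact BanachCategory.norm_id_le (𝕜 := 𝕜) _

/-- The functor that to a bundle `ξ` assigns the presheaf `x ↦ ξ x`. -/
def bundleToPShv (𝕜 : Type) [RCLike 𝕜] (X : Type u) : Bundle.{u} 𝕜 X ⥤ PShv.{u} 𝕜 X where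
  obj ξ := ⟨(Discrete.opposite X).functor ⋙ Discrete.functor ξ.fiber,
    isContractive_of_discrete_op 𝕜 _⟩
  map {ξ ζ} τ := FunCat.mkNat (fun a => Bundle.app τ a.unop.as) ‖τ‖
    (fun a => lp.norm_apply_le_norm ENNReal.top_ne_zero
      (show lp (fun x => ξ.fiber x ⟶ ζ.fiber x) ∞ from τ) a.unop.as)
    (by
      rintro ⟨⟨x⟩⟩ ⟨⟨y⟩⟩ f
      obtain rfl : y = x := Discrete.eq_of_hom f.unop
      rw [show f = 𝟙 _ from Quiver.Hom.unop_inj (Subsingleton.elim _ _)]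
      erw [CategoryTheory.Functor.map_id, CategoryTheory.Functor.map_id]
      exact (Category.id_comp _).trans (Category.comp_id _).symm)

/-! ### Cosheaves -/

/-- A precosheaf `μ` on a complete Boolean algebra is σ-additive if for every countable partition
`𝓔` of every element `E`, the maps `μ F ⟶ μ E` with `F ∈ 𝓔` exhibit `μ E` as a coproduct, that is,
the induced map `∑ F ∈ 𝓔, μ F ⟶ μ E` is an isometric isomorphism. -/
def IsSigmaAdditive {Ω : Type v} [CompleteBooleanAlgebra Ω] {A : Type v₁} [Category.{w} A]
    [HomNormed A] (μ : Ω ⥤ A) : Prop :=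
  ∀ (E : Ω) (𝓔 : Partition E), (𝓔 : Set Ω).Countable →
    IsCoproduct (fun F : (𝓔 : Set Ω) => μ.obj F) (μ.obj E)
      (fun F => μ.map (homOfLE (𝓔.le_of_mem F.2)))

/-- A cosheaf is a σ-additive precosheaf, a precosheaf being a contractive functor on the Boolean
algebra, regarded as a category through its order. -/
structure IsCosheaf {Ω : Type v} [CompleteBooleanAlgebra Ω] {A : Type v₁} [Category.{w} A]
    [HomNormed A] (μ : Ω ⥤ A) : Prop where
  isContractive : IsContractive μ
  isSigmaAdditive : IsSigmaAdditive μ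

/-- Cosheaves on the Boolean algebra of all subsets of `X`, with uniformly bounded natural
transformations. -/
abbrev CoShv (𝕜 : Type) [RCLike 𝕜] (X : Type u) (A : Type v) [Category.{w} A] [HomNormed A]
    [BanachCategory 𝕜 A] :=
  FunCat 𝕜 (fun μ : Set X ⥤ A => IsCosheaf μ)

/-- The inclusion of the atoms `x ↦ {x}`. -/
def atoms (X : Type u) : Discrete X ⥤ Set X := Discrete.functor fun x => {x}

/-- Restriction of a cosheaf `μ` to the atoms, `x ↦ μ {x}`. -/
def restrictToAtoms (𝕜 : Type) [RCLike 𝕜] (X : Type u) (A : Type v) [Category.{w} A] [HomNormed A]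
    [BanachCategory 𝕜 A] : CoShv 𝕜 X A ⥤ ContractiveFun 𝕜 (Discrete X) A :=
  FunCat.precomp (atoms X) (fun _ hμ _ _ f => hμ.isContractive ((atoms X).map f))

open Classical in
/-- The fiber over `x` of the characteristic bundle of `E`: the base field if `x ∈ E`, and zero
otherwise. -/
def charFiber (𝕜 : Type) [RCLike 𝕜] {X : Type u} (E : Set X) (x : X) :
    Submodule 𝕜 (ULift.{u} 𝕜) :=
  if x ∈ E then ⊤ else ⊥

theorem charFiber_mono (𝕜 : Type) [RCLike 𝕜] {X : Type u} {E F : Set X} (h : E ≤ F) (x : X) :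
    charFiber 𝕜 E x ≤ charFiber 𝕜 F x := by
  unfold charFiber
  by_cases hE : x ∈ E
  · rw [if_pos hE, if_pos (h hE)]
  · rw [if_neg hE]; exact bot_le

instance (𝕜 : Type) [RCLike 𝕜] {X : Type u} (E : Set X) (x : X) :
    CompleteSpace (charFiber 𝕜 E x) := by
  by_cases h : x ∈ E
  · rw [charFiber, if_pos h]
    exact (isClosed_univ (X := ULift.{u} 𝕜)).completeSpace_coe
  · rw [charFiber, if_neg h]
    exact (isClosed_singleton (x := (0 : ULift.{u} 𝕜))).completeSpace_coe

/-- The characteristic bundle of a subset `E` of `X`, as a functor of `E`: an inclusion `E ⊆ F` goes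
to the inclusion of fibers. The value at `{x}` is the Dirac bundle `δ x`. -/
def charBundle (𝕜 : Type) [RCLike 𝕜] (X : Type u) : Set X ⥤ Bundle.{u} 𝕜 X where
  obj E := ⟨fun x => ⟨charFiber 𝕜 E x⟩⟩
  map {E F} h := Bundle.mkHom
    (fun x => ((charFiber 𝕜 E x).subtypeL.codRestrict (charFiber 𝕜 F x)
      (fun s => charFiber_mono 𝕜 (leOfHom h) x s.2) :
        charFiber 𝕜 E x →L[𝕜] charFiber 𝕜 F x)) 1
    (fun _ => ContinuousLinearMap.opNorm_le_bound _ zero_le_one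
      (fun s => (one_mul ‖s‖).ge))
  map_id _ := rfl
  map_comp _ _ := rfl

/-- The universal cosheaf `χ`, with values in presheaves: the presheaf of the characteristic
bundle. -/
def universalCosheaf (𝕜 : Type) [RCLike 𝕜] (X : Type u) : Set X ⥤ PShv.{u} 𝕜 X :=
  charBundle 𝕜 X ⋙ bundleToPShv 𝕜 X

theorem isContractive_universalCosheaf (𝕜 : Type) [RCLike 𝕜] (X : Type u) :
    IsContractive (universalCosheaf.{u} 𝕜 X) := fun _ _ _ =>
  lp.norm_le_of_forall_le zero_le_one (fun _ =>
    ContinuousLinearMap.opNorm_le_bound _ zero_le_one (fun s => (one_mul ‖s‖).ge))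

/-! ### Equivalences and Kan extensions -/

/-- An isometric isomorphism in a Banach category. -/
def IsIsometricIso {A : Type v} [Category.{w} A] [HomNormed A] {a b : A} (f : a ⟶ b) : Prop :=
  ‖f‖ ≤ 1 ∧ ∃ g : b ⟶ a, ‖g‖ ≤ 1 ∧ f ≫ g = 𝟙 a ∧ g ≫ f = 𝟙 b

/-- Isometrically fully faithful: the maps on hom-spaces are isometric isomorphisms of Banach
spaces. -/
structure IsIsometricFF (𝕜 : Type) [RCLike 𝕜]
    {B : Type v₁} [Category.{w₁} B] [HomNormed B] [BanachCategory 𝕜 B]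
    {A : Type v₂} [Category.{w₂} A] [HomNormed A] [BanachCategory 𝕜 A] (T : B ⥤ A) : Prop where
  isBanachFunctor : IsBanachFunctor 𝕜 T
  norm_map : ∀ {a b : B} (f : a ⟶ b), ‖T.map f‖ = ‖f‖
  surjective : ∀ a b : B, Function.Surjective (fun f : a ⟶ b => T.map f)

/-- An equivalence of Banach categories: isometrically fully faithful, and essentially surjective
up to isometric isomorphism. -/
structure IsBanachEquivalence (𝕜 : Type) [RCLike 𝕜]
    {B : Type v₁} [Category.{w₁} B] [HomNormed B] [BanachCategory 𝕜 B]
    {A : Type v₂} [Category.{w₂} A] [HomNormed A] [BanachCategory 𝕜 A] (T : B ⥤ A) : Prop where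
  isIsometricFF : IsIsometricFF 𝕜 T
  essSurj : ∀ y : A, ∃ (x : B) (e : T.obj x ⟶ y), IsIsometricIso e

theorem IsBanachFunctor.isContractive_comp {𝕜 : Type} [RCLike 𝕜]
    {C : Type v} [Category.{w} C] {B : Type v₁} [Category.{w₁} B] [HomNormed B]
    [BanachCategory 𝕜 B] {A : Type v₂} [Category.{w₂} A] [HomNormed A] [BanachCategory 𝕜 A]
    {K : C ⥤ B} (hK : IsContractive K) (T : B ⥤ A) (hT : IsBanachFunctor 𝕜 T) :
    IsContractive (K ⋙ T) := fun _ _ f => (hT.norm_map_le (K.map f)).trans (hK f)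

/-- Restriction `T ↦ T K` along a contractive functor `K` from an ordinary category. -/
def restrictAlong {𝕜 : Type} [RCLike 𝕜] {C : Type v} [Category.{w} C]
    {B : Type v₁} [Category.{w₁} B] [HomNormed B] [BanachCategory 𝕜 B]
    {A : Type v₂} [Category.{w₂} A] [HomNormed A] [BanachCategory 𝕜 A]
    (K : C ⥤ B) (hK : IsContractive K) : BanachFun 𝕜 B A ⥤ ContractiveFun 𝕜 C A :=
  FunCat.precomp K (IsBanachFunctor.isContractive_comp hK)

/-- `(L, η)` is the left Kan extension of `F` along `K`: composition with `η : F ⟶ L K` is an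
isometric isomorphism from the space of natural transformations `L ⟶ T` onto the space of natural
transformations `F ⟶ T K`, for every contractive functor `T`. -/
structure IsLeftKanExtension {𝕜 : Type} [RCLike 𝕜] {C : Type v} [Category.{w} C]
    {B : Type v₁} [Category.{w₁} B] [HomNormed B] [BanachCategory 𝕜 B]
    {A : Type v₂} [Category.{w₂} A] [HomNormed A] [BanachCategory 𝕜 A]
    (K : C ⥤ B) (hK : IsContractive K) (F : ContractiveFun 𝕜 C A) (L : BanachFun 𝕜 B A)
    (η : F ⟶ (restrictAlong K hK).obj L) : Prop where
  norm_le : ‖η‖ ≤ 1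
  bijective : ∀ T : BanachFun 𝕜 B A,
    Function.Bijective (fun σ : L ⟶ T => η ≫ (restrictAlong K hK).map σ)
  isometric : ∀ (T : BanachFun 𝕜 B A) (σ : L ⟶ T), ‖η ≫ (restrictAlong K hK).map σ‖ = ‖σ‖

/-- The precosheaf underlying a cosheaf. -/
def CoShv.toPrecosheaf {𝕜 : Type} [RCLike 𝕜] {X : Type u} {A : Type v} [Category.{w} A]
    [HomNormed A] [BanachCategory 𝕜 A] (μ : CoShv 𝕜 X A) : ContractiveFun 𝕜 (Set X) A :=
  ⟨μ.obj, μ.property.isContractive⟩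

/-- `L ξ ≅ ∑ x, ξ x ⊗ a x`, naturally in the presheaf `ξ`: there are tensors `t ξ x` of `ξ x` and
`a x` and maps `t ξ x ⟶ L ξ` exhibiting `L ξ` as their coproduct, such that `L τ` is induced by the
maps `τ x ⊗ 𝟙` for every `τ : ξ ⟶ ζ`. -/
def IsSumOfTensors {𝕜 : Type} [RCLike 𝕜] {X : Type u} {A : Type v} [Category.{w} A]
    [HomNormed A] [BanachCategory 𝕜 A] (L : PShv.{u} 𝕜 X ⥤ A) (a : X → A) : Prop :=
  ∃ (t : PShv.{u} 𝕜 X → X → A)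
    (ten : ∀ (ξ : PShv.{u} 𝕜 X) (x : X), ξ.obj.obj (op ⟨x⟩) →L[𝕜] (a x ⟶ t ξ x))
    (inj : ∀ (ξ : PShv.{u} 𝕜 X) (x : X), t ξ x ⟶ L.obj ξ),
    (∀ ξ x, IsTensor (ξ.obj.obj (op ⟨x⟩)) (a x) (t ξ x) (ten ξ x)) ∧
    (∀ ξ, IsCoproduct (t ξ) (L.obj ξ) (inj ξ)) ∧
    ∀ (ξ ζ : PShv.{u} 𝕜 X) (τ : ξ ⟶ ζ) (x : X) (s : ξ.obj.obj (op ⟨x⟩)),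
      ten ξ x s ≫ inj ξ x ≫ L.map τ =
        ten ζ x (Ban.toCLM (FunCat.app τ (op ⟨x⟩)) s) ≫ inj ζ x

end

/-! The whole theorem rests on one computation done twice. Because `X` is countable, the partition
of `E` into singletons is admissible in σ-additivity, so a cosheaf satisfies `μ E = ∑ x ∈ E, μ {x}`
(`IsCosheaf.isCoproduct_atoms`). Hence natural transformations from a cosheaf to any precosheaf `G`
are the same, isometrically, as bounded families `μ {x} ⟶ G {x}`. Conversely, coproducts of a given
family over all subsets form a cosheaf, by associativity of coproducts; choosing the object `a x`
itself over `{x}` makes restriction to atoms surjective on objects on the nose.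

On the presheaf side, the Dirac presheaf `δ x` represents the fiber at `x`, and every presheaf is `∑
x, ξ x ⊗ δ x` (`isTensorSum_dirac`). A functor `L` of the form `ξ ↦ ∑ x, ξ x ⊗ a x` therefore has
the mapping property that natural transformations `L ⟶ T` into a contractive `T` are bounded
families `a x ⟶ T (δ x)`. Such an `L` is left adjoint to `b ↦ (x ↦ A(a x, b))`, hence cocontinuous,
and every cocontinuous functor on presheaves has this form with `a x = T (δ x)`.

Comparing the two descriptions gives the rest. With `a x = μ {x}`, one has `L (δ x) ≅ μ {x}`, so `L
χ` and `μ` are cosheaves agreeing on atoms and hence are isometrically isomorphic; both `Nat(L, T)`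
and `Nat(μ, T χ)` are spaces of bounded families `μ {x} ⟶ T (δ x)`, which is the Kan extension
property.

Two bridges are needed. Sums of tensors, including tensors and coproducts, are colimits over the
free Banach category on a set (`isWeightedColimit_iff_isTensorSum`), so Banach 2-spaces have them
and cocontinuous functors preserve them. Cocompleteness of presheaves reduces fiberwise to that of
Banach spaces, where the colimit is constructed inside the dual of the space of scalar cocones. -/

noncomputable section

/-! ### Linear structure of Banach categories -/

namespace BanachCategory

variable {𝕜 : Type} [RCLike 𝕜] {A : Type v} [Category.{w} A] [HomNormed A] [BanachCategory 𝕜 A]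

variable (𝕜) in
/-- Precomposition with `f`, as a bounded linear map. -/
def precompL {a b : A} (f : a ⟶ b) (c : A) : (b ⟶ c) →L[𝕜] (a ⟶ c) :=
  LinearMap.mkContinuous
    { toFun := fun g => f ≫ g
      map_add' := comp_add (𝕜 := 𝕜) f
      map_smul' := fun r g => comp_smul r f g } ‖f‖ (fun g => norm_comp_le (𝕜 := 𝕜) f g)

variable (𝕜) in
/-- Postcomposition with `g`, as a bounded linear map. -/
def postcompL (a : A) {b c : A} (g : b ⟶ c) : (a ⟶ b) →L[𝕜] (a ⟶ c) :=
  LinearMap.mkContinuous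
    { toFun := fun f => f ≫ g
      map_add' := fun f f' => add_comp (𝕜 := 𝕜) f f' g
      map_smul' := fun r f => smul_comp r f g } ‖g‖
    (fun f => (norm_comp_le (𝕜 := 𝕜) f g).trans_eq (mul_comm _ _))

theorem norm_postcompL_le (a : A) {b c : A} (g : b ⟶ c) : ‖postcompL 𝕜 a g‖ ≤ ‖g‖ :=
  LinearMap.mkContinuous_norm_le _ (norm_nonneg _) _

theorem comp_zero (𝕜 : Type) [RCLike 𝕜] {A : Type v} [Category.{w} A] [HomNormed A]
    [BanachCategory 𝕜 A] {a b : A} (f : a ⟶ b) (c : A) : f ≫ (0 : b ⟶ c) = 0 :=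
  (precompL 𝕜 f c).map_zero

theorem zero_comp (𝕜 : Type) [RCLike 𝕜] {A : Type v} [Category.{w} A] [HomNormed A]
    [BanachCategory 𝕜 A] (a : A) {b c : A} (g : b ⟶ c) : (0 : a ⟶ b) ≫ g = 0 :=
  (postcompL 𝕜 a g).map_zero

theorem norm_comp_le_of_le (𝕜 : Type) [RCLike 𝕜] {A : Type v} [Category.{w} A] [HomNormed A]
    [BanachCategory 𝕜 A] {a b c : A} {f : a ⟶ b} {g : b ⟶ c} {C : ℝ} (hf : ‖f‖ ≤ 1)
    (hg : ‖g‖ ≤ C) : ‖f ≫ g‖ ≤ C :=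
  (norm_comp_le (𝕜 := 𝕜) f g).trans ((mul_le_of_le_one_left (norm_nonneg _) hf).trans hg)

theorem norm_comp_le_of_le' (𝕜 : Type) [RCLike 𝕜] {A : Type v} [Category.{w} A] [HomNormed A]
    [BanachCategory 𝕜 A] {a b c : A} {f : a ⟶ b} {g : b ⟶ c} {C : ℝ} (hf : ‖f‖ ≤ C)
    (hg : ‖g‖ ≤ 1) : ‖f ≫ g‖ ≤ C :=
  (norm_comp_le (𝕜 := 𝕜) f g).trans ((mul_le_of_le_one_right (norm_nonneg _) hg).trans hf)

end BanachCategory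

open BanachCategory

namespace IsBanachFunctor

variable {𝕜 : Type} [RCLike 𝕜] {B : Type v₁} [Category.{w₁} B] [HomNormed B] [BanachCategory 𝕜 B]
  {A : Type v₂} [Category.{w₂} A] [HomNormed A] [BanachCategory 𝕜 A] {T : B ⥤ A}

/-- The action of a contractive functor on a hom-space. -/
def mapL (hT : IsBanachFunctor 𝕜 T) (a b : B) : (a ⟶ b) →L[𝕜] (T.obj a ⟶ T.obj b) :=
  LinearMap.mkContinuous
    { toFun := fun f => T.map f
      map_add' := hT.map_add
      map_smul' := hT.map_smul } 1 (fun f => (hT.norm_map_le f).trans_eq (one_mul _).symm)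

theorem map_zero (hT : IsBanachFunctor 𝕜 T) (a b : B) : T.map (0 : a ⟶ b) = 0 :=
  (hT.mapL a b).map_zero

theorem comp {C : Type v} [Category.{w} C] [HomNormed C] [BanachCategory 𝕜 C] {S : C ⥤ B}
    (hS : IsBanachFunctor 𝕜 S) (hT : IsBanachFunctor 𝕜 T) : IsBanachFunctor 𝕜 (S ⋙ T) where
  map_add f g := (congrArg T.map (hS.map_add f g)).trans (hT.map_add _ _)
  map_smul r f := (congrArg T.map (hS.map_smul r f)).trans (hT.map_smul _ _)
  norm_map_le f := (hT.norm_map_le _).trans (hS.norm_map_le f)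

end IsBanachFunctor

/-! ### Sums of tensors -/

/-- `c`, with the maps `inj i : V i → A(a i, c)`, is the sum `∑ i, V i ⊗ a i`: composition with
`inj` is an isometric isomorphism from `A(c, b)` onto the space of uniformly bounded families in
`∏ i, Ban(V i, A(a i, b))`, for every `b`. -/
structure IsTensorSum {𝕜 : Type} [RCLike 𝕜] {A : Type v} [Category.{w} A] [HomNormed A]
    [BanachCategory 𝕜 A] {ι : Type v₂} (V : ι → Ban.{u} 𝕜) (a : ι → A) (c : A)
    (inj : ∀ i, V i →L[𝕜] (a i ⟶ c)) : Prop where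
  norm_le : ∀ i, ‖inj i‖ ≤ 1
  desc : ∀ (b : A) (φ : ∀ i, V i →L[𝕜] (a i ⟶ b)) (C : ℝ), 0 ≤ C → (∀ i, ‖φ i‖ ≤ C) →
    ∃ h : c ⟶ b, ‖h‖ ≤ C ∧ ∀ i s, inj i s ≫ h = φ i s
  uniq : ∀ (b : A) (h h' : c ⟶ b), (∀ i s, inj i s ≫ h = inj i s ≫ h') → h = h'

section TensorSum

variable {𝕜 : Type} [RCLike 𝕜] {A : Type v} [Category.{w} A] [HomNormed A] [BanachCategory 𝕜 A]

theorem IsTensorSum.norm_inj_apply_le {ι : Type v₂} {V : ι → Ban.{u} 𝕜} {a : ι → A} {c : A}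
    {inj : ∀ i, V i →L[𝕜] (a i ⟶ c)} (h : IsTensorSum V a c inj) (i : ι) (s : V i) :
    ‖inj i s‖ ≤ ‖s‖ :=
  (inj i).le_of_opNorm_le (h.norm_le i) s |>.trans_eq (one_mul _)

theorem IsTensorSum.isTensor {V : Ban.{u} 𝕜} {a t : A} {ten : V →L[𝕜] (a ⟶ t)}
    (h : IsTensorSum (fun _ : PUnit.{u + 1} => V) (fun _ => a) t (fun _ => ten)) :
    IsTensor V a t ten where
  norm_le := h.norm_le ⟨⟩
  desc b φ := by
    obtain ⟨k, hk, hk'⟩ := h.desc b (fun _ => φ) ‖φ‖ (norm_nonneg _) (fun _ => le_rfl)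
    exact ⟨k, hk, hk' ⟨⟩⟩
  uniq b k k' hk := h.uniq b k k' (fun _ => hk)

/-- A sum of tensors is the coproduct of the tensors. -/
theorem IsTensorSum.exists_isCoproduct {ι : Type v₂} {V : ι → Ban.{u} 𝕜} {a : ι → A} {c : A}
    {inj : ∀ i, V i →L[𝕜] (a i ⟶ c)} (h : IsTensorSum V a c inj) {t : ι → A}
    {ten : ∀ i, V i →L[𝕜] (a i ⟶ t i)} (ht : ∀ i, IsTensor (V i) (a i) (t i) (ten i)) :
    ∃ j : ∀ i, t i ⟶ c, IsCoproduct t c j ∧ ∀ i s, ten i s ≫ j i = inj i s := by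
  choose j hj hj' using fun i => (ht i).desc c (inj i)
  refine ⟨j, ⟨fun i => (hj i).trans (h.norm_le i), fun b f C hC hf => ?_, fun b k k' hk => ?_⟩, hj'⟩
  · have hn : ∀ i, ‖(postcompL 𝕜 (a i) (f i)).comp (ten i)‖ ≤ C := fun i =>
      (ContinuousLinearMap.opNorm_comp_le _ _).trans
        ((mul_le_of_le_one_right (norm_nonneg _) (ht i).norm_le).trans
          ((norm_postcompL_le _ _).trans (hf i)))
    obtain ⟨k, hk, hk'⟩ := h.desc b (fun i => (postcompL 𝕜 (a i) (f i)).comp (ten i)) C hC hn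
    refine ⟨k, hk, fun i => (ht i).uniq b _ _ fun s => ?_⟩
    rw [← Category.assoc, hj' i s, hk' i s]
    rfl
  · refine h.uniq b k k' fun i s => ?_
    rw [← hj' i s, Category.assoc, Category.assoc, hk i]

variable (𝕜) in
/-- The base field as a Banach space in the universe `u`. -/
def scalarBan : Ban.{u} 𝕜 := ⟨ULift.{u} 𝕜⟩

variable (𝕜) in
/-- The bounded linear map `s ↦ s • f` on the base field. -/
def scalarMap {E : Type w} [NormedAddCommGroup E] [NormedSpace 𝕜 E] (f : E) :
    scalarBan.{u} 𝕜 →L[𝕜] E :=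
  LinearMap.mkContinuous
    { toFun := fun s : ULift.{u} 𝕜 => s.down • f
      map_add' := fun s t => add_smul s.down t.down f
      map_smul' := fun r s => mul_smul r s.down f } ‖f‖
    (fun s => (norm_smul s.down f).trans_le (mul_comm _ _).le)

theorem scalarMap_apply {E : Type w} [NormedAddCommGroup E] [NormedSpace 𝕜 E] (f : E)
    (s : ULift.{u} 𝕜) : scalarMap.{u} 𝕜 f s = s.down • f := rfl

theorem norm_scalarMap_le {E : Type w} [NormedAddCommGroup E] [NormedSpace 𝕜 E] (f : E) :
    ‖scalarMap.{u} 𝕜 f‖ ≤ ‖f‖ :=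
  LinearMap.mkContinuous_norm_le _ (norm_nonneg _) _

theorem scalarMap_one {E : Type w} [NormedAddCommGroup E] [NormedSpace 𝕜 E] (f : E) :
    scalarMap.{u} 𝕜 f (ULift.up 1 : ULift.{u} 𝕜) = f := one_smul 𝕜 f

theorem norm_scalar_one : ‖(ULift.up 1 : ULift.{u} 𝕜)‖ = 1 := norm_one (α := 𝕜)

theorem eq_scalarMap {E : Type w} [NormedAddCommGroup E] [NormedSpace 𝕜 E]
    (φ : scalarBan.{u} 𝕜 →L[𝕜] E) : φ = scalarMap.{u} 𝕜 (φ (ULift.up 1 : ULift.{u} 𝕜)) := by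
  ext s
  exact (congrArg φ (congrArg ULift.up (mul_one (ULift.down s)).symm)).trans
    (φ.map_smul (ULift.down s) (ULift.up 1 : ULift.{u} 𝕜))

-- This is `𝕜 ⊗ a ≅ a`: a bounded linear map on the base field is determined by its value at `1`,
-- which has the same norm. It makes coproducts a special case of sums of tensors, and so of
-- weighted colimits.
variable (𝕜) in
theorem isCoproduct_iff_isTensorSum {ι : Type v₂} {a : ι → A} {c : A} {inj : ∀ i, a i ⟶ c} :
    IsCoproduct a c inj ↔
      IsTensorSum (fun _ => scalarBan.{u} 𝕜) a c (fun i => scalarMap.{u} 𝕜 (inj i)) := by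
  have key : ∀ (b : A) (k : c ⟶ b) i (s : ULift.{u} 𝕜),
      scalarMap.{u} 𝕜 (inj i) s ≫ k = s.down • (inj i ≫ k) := fun b k i s => by
    rw [scalarMap_apply, smul_comp]
  constructor
  · refine fun h => ⟨fun i => (norm_scalarMap_le _).trans (h.norm_le i), fun b φ C hC hφ => ?_,
      fun b k k' hk => h.uniq b k k' fun i => ?_⟩
    · obtain ⟨k, hk, hk'⟩ := h.desc b (fun i => φ i (ULift.up 1 : ULift.{u} 𝕜)) C hC fun i =>
        ((φ i).le_of_opNorm_le (hφ i) _).trans_eq (by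
          exact (congrArg (C * ·) norm_scalar_one).trans (mul_one C))
      refine ⟨k, hk, fun i s => (key b k i s).trans ?_⟩
      rw [hk' i]
      exact (DFunLike.congr_fun (eq_scalarMap (φ i)) s).symm
    · have := hk i (ULift.up 1 : ULift.{u} 𝕜)
      rwa [scalarMap_one] at this
  · refine fun h => ⟨fun i => ?_, fun b f C hC hf => ?_, fun b k k' hk => h.uniq b k k' fun i s => ?_⟩
    · have := h.norm_inj_apply_le i (ULift.up 1 : ULift.{u} 𝕜)
      rw [scalarMap_one] at this
      exact this.trans_eq norm_scalar_one
    · obtain ⟨k, hk, hk'⟩ := h.desc b (fun i => scalarMap.{u} 𝕜 (f i)) C hC fun i =>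
        (norm_scalarMap_le _).trans (hf i)
      refine ⟨k, hk, fun i => ?_⟩
      have := hk' i (ULift.up 1 : ULift.{u} 𝕜)
      rwa [scalarMap_one, scalarMap_one] at this
    · refine (key b k i s).trans (Eq.trans ?_ (key b k' i s).symm)
      rw [hk i]

end TensorSum

/-! ### The discrete Banach category on a set -/

section CharFiber

variable {𝕜 : Type} [RCLike 𝕜] {X : Type u}

theorem mem_charFiber {E : Set X} {x : X} {s : ULift.{u} 𝕜} :
    s ∈ charFiber 𝕜 E x ↔ (x ∉ E → s = 0) := by
  unfold charFiber
  by_cases h : x ∈ E <;> simp [h]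

theorem mem_charFiber_of_mem {E : Set X} {x : X} (h : x ∈ E) (s : ULift.{u} 𝕜) :
    s ∈ charFiber 𝕜 E x := mem_charFiber.2 fun h' => absurd h h'

theorem charFiber_eq_zero {E : Set X} {x : X} (h : x ∉ E) (s : charFiber 𝕜 E x) : s = 0 :=
  Subtype.ext (mem_charFiber.1 s.2 h)

/-- The element `1` of the fiber of the Dirac bundle over `x`. -/
def charFiberOne (𝕜 : Type) [RCLike 𝕜] {E : Set X} {x : X} (h : x ∈ E) : charFiber 𝕜 E x :=
  ⟨ULift.up 1, mem_charFiber_of_mem h _⟩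

theorem eq_smul_charFiberOne {E : Set X} {x : X} (h : x ∈ E) (s : charFiber 𝕜 E x) :
    s = s.1.down • charFiberOne 𝕜 h :=
  Subtype.ext (congrArg ULift.up (mul_one s.1.down).symm)

theorem norm_charFiberOne {E : Set X} {x : X} (h : x ∈ E) : ‖charFiberOne 𝕜 h‖ = 1 :=
  norm_one (α := 𝕜)

end CharFiber

/-- The free Banach category on the set `ι`: the hom-space from `i` to `j` is the base field if
`i = j`, and zero otherwise. -/
structure DiscreteBanach (𝕜 : Type) [RCLike 𝕜] (ι : Type u) : Type u where
  pt : ι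

namespace DiscreteBanach

variable {𝕜 : Type} [RCLike 𝕜] {ι : Type u}

theorem mul_mem_charFiber {i j k : ι} {r s : ULift.{u} 𝕜} (hr : r ∈ charFiber 𝕜 {i} j)
    (hs : s ∈ charFiber 𝕜 {j} k) : ULift.up (r.down * s.down) ∈ charFiber 𝕜 {i} k := by
  refine mem_charFiber.2 fun h => ?_
  by_cases hj : j ∈ ({i} : Set ι)
  · rw [Set.mem_singleton_iff.1 hj] at hs
    rw [mem_charFiber.1 hs h]
    exact congrArg ULift.up (mul_zero _)
  · rw [mem_charFiber.1 hr hj]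
    exact congrArg ULift.up (zero_mul _)

instance : Category.{u} (DiscreteBanach 𝕜 ι) where
  Hom i j := charFiber 𝕜 ({i.pt} : Set ι) j.pt
  id i := charFiberOne 𝕜 (Set.mem_singleton i.pt)
  comp f g := ⟨ULift.up (f.1.down * g.1.down), mul_mem_charFiber f.2 g.2⟩
  id_comp _ := Subtype.ext (congrArg ULift.up (one_mul _))
  comp_id _ := Subtype.ext (congrArg ULift.up (mul_one _))
  assoc _ _ _ := Subtype.ext (congrArg ULift.up (mul_assoc _ _ _))

instance : HomNormed (DiscreteBanach 𝕜 ι) where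
  homGroup i j := inferInstanceAs (NormedAddCommGroup (charFiber 𝕜 ({i.pt} : Set ι) j.pt))

instance : BanachCategory 𝕜 (DiscreteBanach 𝕜 ι) where
  homSpace i j := inferInstanceAs (NormedSpace 𝕜 (charFiber 𝕜 ({i.pt} : Set ι) j.pt))
  homComplete i j := inferInstanceAs (CompleteSpace (charFiber 𝕜 ({i.pt} : Set ι) j.pt))
  add_comp _ _ _ := Subtype.ext (congrArg ULift.up (add_mul _ _ _))
  comp_add _ _ _ := Subtype.ext (congrArg ULift.up (mul_add _ _ _))
  smul_comp _ _ _ := Subtype.ext (congrArg ULift.up (mul_assoc _ _ _))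
  comp_smul _ _ _ := Subtype.ext (congrArg ULift.up (mul_left_comm _ _ _))
  norm_comp_le f g := (norm_mul f.1.down g.1.down).le
  norm_id_le i := (norm_charFiberOne (Set.mem_singleton i.pt)).le

/-- The coefficient of a morphism. -/
def coeff {i j : DiscreteBanach 𝕜 ι} (f : i ⟶ j) : 𝕜 :=
  (show charFiber 𝕜 ({i.pt} : Set ι) j.pt from f).1.down

theorem eq_coeff_smul_id {i : DiscreteBanach 𝕜 ι} (f : i ⟶ i) : f = coeff f • 𝟙 i :=
  eq_smul_charFiberOne (Set.mem_singleton i.pt) f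

theorem eq_zero_of_ne {i j : DiscreteBanach 𝕜 ι} (h : i ≠ j) (f : i ⟶ j) : f = 0 :=
  charFiber_eq_zero (fun h' => h (by
    cases i; cases j; exact congrArg _ (Set.mem_singleton_iff.1 h').symm)) f

theorem coeff_eq_zero_of_ne {i j : DiscreteBanach 𝕜 ι} (h : i ≠ j) (f : i ⟶ j) : coeff f = 0 := by
  rw [eq_zero_of_ne h f]; rfl

variable {A : Type v} [Category.{w} A] [HomNormed A] [BanachCategory 𝕜 A]

open Classical in
/-- The contractive functor on the discrete Banach category defined by a family of objects. -/
def functor (a : ι → A) : DiscreteBanach 𝕜 ι ⥤ A where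
  obj i := a i.pt
  map {i j} f := if h : i = j then coeff f • eqToHom (congrArg (fun k => a k.pt) h) else 0
  map_id i := by
    rw [dif_pos rfl, eqToHom_refl]
    exact one_smul 𝕜 _
  map_comp {i j k} f g := by
    by_cases hij : i = j
    · subst hij
      by_cases hik : i = k
      · subst hik
        simp only [dif_pos, eqToHom_refl, comp_smul, Category.comp_id]
        rw [smul_smul, mul_comm]
        rfl
      · simp only [dif_neg hik]
        exact (comp_zero 𝕜 _ _).symm
    · simp only [dif_neg hij, zero_comp 𝕜]
      -- The case `i = k ≠ j` really occurs: a composite passing through a different object has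
      -- coefficient zero, matching the zero on the other side.
      split_ifs with h
      · have : coeff (f ≫ g) = 0 := by
          rw [eq_zero_of_ne hij f, zero_comp 𝕜]; rfl
        rw [this, zero_smul]
      · rfl

theorem isBanachFunctor_functor (a : ι → A) :
    IsBanachFunctor 𝕜 (functor a : DiscreteBanach 𝕜 ι ⥤ A) where
  map_add {i j} f g := by
    simp only [functor]
    split_ifs with h
    · exact add_smul (coeff f) (coeff g) _
    · exact (add_zero 0).symm
  map_smul {i j} r f := by
    simp only [functor]
    split_ifs with h
    · exact mul_smul r (coeff f) _
    · exact (smul_zero r).symm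
  norm_map_le {i j} f := by
    simp only [functor]
    split_ifs with h
    · subst h
      exact (norm_smul (coeff f) (𝟙 (a i.pt))).trans_le
        (mul_le_of_le_one_right (norm_nonneg _) (norm_id_le (𝕜 := 𝕜) _))
    · exact norm_zero.trans_le (norm_nonneg f)

/-- The self-duality of the discrete Banach category. -/
def dual : (DiscreteBanach 𝕜 ι)ᵒᵖ ⥤ DiscreteBanach 𝕜 ι where
  obj i := i.unop
  map f := ⟨ULift.up (coeff f.unop), mem_charFiber.2 fun h =>
    congrArg ULift.up (coeff_eq_zero_of_ne (fun e => h (congrArg pt e)) f.unop)⟩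
  map_id _ := rfl
  map_comp _ _ := Subtype.ext (congrArg ULift.up (mul_comm _ _))

/-- The weight on the discrete Banach category defined by a family of Banach spaces. -/
def weight (V : ι → Ban.{u} 𝕜) : (DiscreteBanach 𝕜 ι)ᵒᵖ ⥤ Ban.{u} 𝕜 := dual ⋙ functor V

theorem isWeight_weight (V : ι → Ban.{u} 𝕜) : IsWeight (weight V) where
  map_add f g := (isBanachFunctor_functor V).map_add (dual.map f.op) (dual.map g.op)
  map_smul r f := (isBanachFunctor_functor V).map_smul r (dual.map f.op)
  norm_map_le f := (isBanachFunctor_functor V).norm_map_le (dual.map f.op)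

end DiscreteBanach

open DiscreteBanach in
/-- A colimit over a discrete Banach category is a sum of tensors. -/
theorem isWeightedColimit_iff_isTensorSum {𝕜 : Type} [RCLike 𝕜] {A : Type v} [Category.{u} A]
    [HomNormed A] [BanachCategory 𝕜 A] {ι : Type u} {V : ι → Ban.{u} 𝕜}
    {D : DiscreteBanach 𝕜 ι ⥤ A} (hD : IsBanachFunctor 𝕜 D) {c : A}
    {inj : ∀ i, V i →L[𝕜] (D.obj ⟨i⟩ ⟶ c)} :
    IsWeightedColimit (weight V) D c (fun j s => inj j.pt s) ↔
      IsTensorSum V (fun i => D.obj ⟨i⟩) c inj := by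
  have cocone : ∀ (b : A) (φ : ∀ i, V i →L[𝕜] (D.obj ⟨i⟩ ⟶ b)) (C : ℝ), (∀ i, ‖φ i‖ ≤ C) →
      IsCocone (weight V) D b C (fun j s => φ j.pt s) := fun b φ C hφ =>
    { map_add := fun j s t => (φ j.pt).map_add s t
      map_smul := fun j r s => (φ j.pt).map_smul r s
      norm_le := fun j s => (φ j.pt).le_of_opNorm_le (hφ j.pt) s
      natural := fun {i j} f s => by
        -- Naturality costs nothing over a discrete base: endomorphisms are scalar multiples of the
        -- identity, on which `W` and `D` act by the same scalar, and all other morphisms are zero.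
        by_cases h : i = j
        · subst h
          have h1 : (weight V).map f.op = coeff f • 𝟙 _ := by
            conv_lhs => rw [eq_coeff_smul_id f, (isWeight_weight V).map_smul, op_id,
              (weight V).map_id]
          have h2 : D.map f = coeff f • 𝟙 _ := by
            conv_lhs => rw [eq_coeff_smul_id f, hD.map_smul, D.map_id]
          rw [h1, h2, smul_comp, Category.id_comp]
          exact (φ i.pt).map_smul (coeff f) s
        · have h1 : (weight V).map f.op = 0 := dif_neg (Ne.symm h)
          rw [h1, eq_zero_of_ne h f, hD.map_zero, zero_comp 𝕜]
          exact (φ i.pt).map_zero }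
  constructor
  · refine fun h => ⟨fun i => ContinuousLinearMap.opNorm_le_bound _ zero_le_one
      (h.isCocone.norm_le ⟨i⟩), fun b φ C hC hφ => ?_,
      fun b k k' hk => h.uniq b k k' fun j s => hk j.pt s⟩
    obtain ⟨k, hk, hk'⟩ := h.desc b _ C hC (cocone b φ C hφ)
    exact ⟨k, hk, fun i s => hk' ⟨i⟩ s⟩
  · refine fun h => ⟨cocone c inj 1 h.norm_le, fun b φ C hC hφ => ?_,
      fun b k k' hk => h.uniq b k k' fun i s => hk ⟨i⟩ s⟩
    obtain ⟨k, hk, hk'⟩ := h.desc b (fun i => LinearMap.mkContinuous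
      { toFun := φ ⟨i⟩
        map_add' := hφ.map_add ⟨i⟩
        map_smul' := hφ.map_smul ⟨i⟩ } C (hφ.norm_le ⟨i⟩)) C hC
      (fun i => LinearMap.mkContinuous_norm_le _ hC _)
    exact ⟨k, hk, fun j s => hk' j.pt s⟩

/-! ### Sums of tensors, tensors and coproducts in Banach 2-spaces, and their preservation. -/

section TwoSpace

variable {𝕜 : Type} [RCLike 𝕜] {A : Type v} [Category.{u} A] [HomNormed A] [BanachCategory 𝕜 A]

theorem IsBanachTwoSpace.exists_isTensorSum (hA : IsBanachTwoSpace 𝕜 A) {ι : Type u}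
    (V : ι → Ban.{u} 𝕜) (a : ι → A) :
    ∃ (c : A) (inj : ∀ i, V i →L[𝕜] (a i ⟶ c)), IsTensorSum V a c inj := by
  obtain ⟨c, inj, h⟩ := hA (DiscreteBanach 𝕜 ι) (DiscreteBanach.weight V)
    (DiscreteBanach.functor a) (DiscreteBanach.isWeight_weight V)
    (DiscreteBanach.isBanachFunctor_functor a)
  refine ⟨c, fun i => LinearMap.mkContinuous
      { toFun := inj ⟨i⟩
        map_add' := h.isCocone.map_add ⟨i⟩
        map_smul' := h.isCocone.map_smul ⟨i⟩ } 1 (h.isCocone.norm_le ⟨i⟩), ?_⟩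
  exact (isWeightedColimit_iff_isTensorSum (V := V)
    (DiscreteBanach.isBanachFunctor_functor (𝕜 := 𝕜) a)).1 h

theorem IsBanachTwoSpace.exists_isTensor (hA : IsBanachTwoSpace 𝕜 A) (V : Ban.{u} 𝕜) (a : A) :
    ∃ (t : A) (ten : V →L[𝕜] (a ⟶ t)), IsTensor V a t ten := by
  obtain ⟨t, ten, h⟩ := hA.exists_isTensorSum (fun _ : PUnit.{u + 1} => V) (fun _ => a)
  exact ⟨t, ten ⟨⟩, h.isTensor⟩

theorem IsBanachTwoSpace.exists_isCoproduct (hA : IsBanachTwoSpace 𝕜 A) {ι : Type u} (a : ι → A) :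
    ∃ (c : A) (inj : ∀ i, a i ⟶ c), IsCoproduct a c inj := by
  obtain ⟨c, inj, h⟩ := hA.exists_isTensorSum (fun _ : ι => scalarBan.{u} 𝕜) a
  refine ⟨c, fun i => inj i (ULift.up 1 : ULift.{u} 𝕜), (isCoproduct_iff_isTensorSum 𝕜).2 ?_⟩
  rwa [show (fun i => scalarMap.{u} 𝕜 (inj i (ULift.up 1 : ULift.{u} 𝕜))) = inj from
    funext fun i => (eq_scalarMap (inj i)).symm]

variable {B : Type v₁} [Category.{u} B] [HomNormed B] [BanachCategory 𝕜 B] {T : B ⥤ A}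

/-- The sum is a weighted colimit over the free Banach category on the index set, so it is
preserved. The composite of the diagram with `T` is again a contractive functor on that category,
which is all that the translation back requires. -/
theorem IsCocontinuous.isTensorSum (hT : IsCocontinuous 𝕜 T) {ι : Type u} {V : ι → Ban.{u} 𝕜}
    {a : ι → B} {c : B} {inj : ∀ i, V i →L[𝕜] (a i ⟶ c)} (h : IsTensorSum V a c inj) :
    IsTensorSum V (fun i => T.obj (a i)) (T.obj c)
      (fun i => (hT.isBanachFunctor.mapL (a i) c).comp (inj i)) :=
  (isWeightedColimit_iff_isTensorSum
    ((DiscreteBanach.isBanachFunctor_functor (𝕜 := 𝕜) a).comp hT.isBanachFunctor)).1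
    (hT.preserves _ _ _ (DiscreteBanach.isWeight_weight V)
      (DiscreteBanach.isBanachFunctor_functor (𝕜 := 𝕜) a) c _
      ((isWeightedColimit_iff_isTensorSum
        (DiscreteBanach.isBanachFunctor_functor (𝕜 := 𝕜) a)).2 h))

theorem IsCocontinuous.isCoproduct (hT : IsCocontinuous 𝕜 T) {ι : Type u} {a : ι → B} {c : B}
    {inj : ∀ i, a i ⟶ c} (h : IsCoproduct a c inj) :
    IsCoproduct (fun i => T.obj (a i)) (T.obj c) (fun i => T.map (inj i)) := by
  rw [isCoproduct_iff_isTensorSum.{u} 𝕜] at h ⊢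
  convert hT.isTensorSum h using 2 with i
  ext s
  exact (hT.isBanachFunctor.map_smul s.down (inj i)).symm

end TwoSpace

end

noncomputable section

set_option maxSynthPendingDepth 3

open BanachCategory

/-! ### Cocompleteness of the category of Banach spaces -/

namespace Ban

variable {𝕜 : Type} [RCLike 𝕜] {J : Type u} [Category.{u} J]

/-- The Banach space of bounded bilinear forms. -/
def bilin (V W : Ban.{u} 𝕜) : Ban.{u} 𝕜 := ⟨V →L[𝕜] W →L[𝕜] 𝕜⟩

/-- The bounded bilinear map underlying a bilinear form. -/
def bilin.toCLM {V W : Ban.{u} 𝕜} (β : bilin V W) : V →L[𝕜] W →L[𝕜] 𝕜 := β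

/-- The scalar cocones: the uniformly bounded families of bilinear forms on `W j × D j` that are
natural in `j`. -/
def scalarCocones (W : Jᵒᵖ ⥤ Ban.{u} 𝕜) (D : J ⥤ Ban.{u} 𝕜) :
    Submodule 𝕜 (lp (fun j : J => bilin (W.obj (op j)) (D.obj j)) ∞) where
  carrier := {β | ∀ ⦃i j : J⦄ (f : i ⟶ j) (s : W.obj (op j)) (d : D.obj i),
    bilin.toCLM (β i) (toCLM (W.map f.op) s) d = bilin.toCLM (β j) s (toCLM (D.map f) d)}
  zero_mem' _ _ _ _ _ := rfl
  add_mem' hβ hγ _ _ f s d := congrArg₂ (· + ·) (hβ f s d) (hγ f s d)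
  smul_mem' r _ hβ _ _ f s d := congrArg (r • ·) (hβ f s d)

/-- The normed space of scalar cocones. -/
def Cocones (W : Jᵒᵖ ⥤ Ban.{u} 𝕜) (D : J ⥤ Ban.{u} 𝕜) : Type u := scalarCocones W D

instance (W : Jᵒᵖ ⥤ Ban.{u} 𝕜) (D : J ⥤ Ban.{u} 𝕜) : NormedAddCommGroup (Cocones W D) :=
  inferInstanceAs (NormedAddCommGroup (scalarCocones W D))

instance (W : Jᵒᵖ ⥤ Ban.{u} 𝕜) (D : J ⥤ Ban.{u} 𝕜) : NormedSpace 𝕜 (Cocones W D) :=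
  inferInstanceAs (NormedSpace 𝕜 (scalarCocones W D))

variable {W : Jᵒᵖ ⥤ Ban.{u} 𝕜} {D : J ⥤ Ban.{u} 𝕜}

namespace Cocones

/-- The component of a scalar cocone. -/
def app (β : Cocones W D) (j : J) : W.obj (op j) →L[𝕜] D.obj j →L[𝕜] 𝕜 :=
  bilin.toCLM ((show scalarCocones W D from β).1 j)

theorem norm_app_le (β : Cocones W D) (j : J) : ‖β.app j‖ ≤ ‖β‖ :=
  lp.norm_apply_le_norm ENNReal.top_ne_zero (show scalarCocones W D from β).1 j

theorem natural (β : Cocones W D) {i j : J} (f : i ⟶ j) (s : W.obj (op j)) (d : D.obj i) :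
    β.app i (toCLM (W.map f.op) s) d = β.app j s (toCLM (D.map f) d) :=
  (show scalarCocones W D from β).2 f s d

/-- A scalar cocone from its components. -/
def mk (φ : ∀ j, W.obj (op j) →L[𝕜] D.obj j →L[𝕜] 𝕜) (K : ℝ) (hK : ∀ j, ‖φ j‖ ≤ K)
    (hn : ∀ {i j : J} (f : i ⟶ j) (s : W.obj (op j)) (d : D.obj i),
      φ i (toCLM (W.map f.op) s) d = φ j s (toCLM (D.map f) d)) : Cocones W D :=
  (⟨⟨φ, memℓp_infty ⟨K, by rintro _ ⟨j, rfl⟩; exact hK j⟩⟩, fun _ _ => hn⟩ : scalarCocones W D)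

theorem norm_le {β : Cocones W D} {K : ℝ} (hK : 0 ≤ K) (h : ∀ j, ‖β.app j‖ ≤ K) : ‖β‖ ≤ K :=
  lp.norm_le_of_forall_le hK h

/-- The component of a scalar cocone, as a bounded linear map. -/
def appL (W : Jᵒᵖ ⥤ Ban.{u} 𝕜) (D : J ⥤ Ban.{u} 𝕜) (j : J) :
    Cocones W D →L[𝕜] W.obj (op j) →L[𝕜] D.obj j →L[𝕜] 𝕜 :=
  LinearMap.mkContinuous
    { toFun := fun β => β.app j
      map_add' := fun _ _ => rfl
      map_smul' := fun _ _ => rfl } 1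
    (fun β => (β.norm_app_le j).trans_eq (one_mul ‖β‖).symm)

end Cocones

/-- Evaluation of scalar cocones, as an element of the dual space. -/
def dualEval (W : Jᵒᵖ ⥤ Ban.{u} 𝕜) (D : J ⥤ Ban.{u} 𝕜) (j : J) :
    W.obj (op j) →L[𝕜] D.obj j →L[𝕜] StrongDual 𝕜 (Cocones W D) :=
  -- The inner flip moves `s` in front of the cocone, the outer one exchanges the cocone with `d`;
  -- the result is `(s, d) ↦ (β ↦ β j s d)`.
  (ContinuousLinearMap.flipₗᵢ 𝕜 (Cocones W D) (D.obj j) 𝕜).toContinuousLinearEquiv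
    |>.toContinuousLinearMap.comp (Cocones.appL W D j).flip

theorem norm_dualEval_apply_le (j : J) (s : W.obj (op j)) : ‖dualEval W D j s‖ ≤ ‖s‖ := by
  have h1 : ‖Cocones.appL W D j‖ ≤ 1 := LinearMap.mkContinuous_norm_le _ zero_le_one _
  refine ((LinearIsometryEquiv.norm_map (ContinuousLinearMap.flipₗᵢ 𝕜 (Cocones W D)
    (D.obj j) 𝕜) ((Cocones.appL W D j).flip s))).trans_le ?_
  refine ((Cocones.appL W D j).flip.le_opNorm s).trans ?_
  rw [ContinuousLinearMap.opNorm_flip]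
  exact mul_le_of_le_one_left (norm_nonneg _) h1

/-- The linear span of the evaluations. -/
def evalSpan (W : Jᵒᵖ ⥤ Ban.{u} 𝕜) (D : J ⥤ Ban.{u} 𝕜) :
    Submodule 𝕜 (StrongDual 𝕜 (Cocones W D)) :=
  Submodule.span 𝕜 {Λ | ∃ j s d, dualEval W D j s d = Λ}

theorem dualEval_mem (j : J) (s : W.obj (op j)) (d : D.obj j) :
    dualEval W D j s d ∈ (evalSpan W D).topologicalClosure :=
  Submodule.le_topologicalClosure _ (Submodule.subset_span ⟨j, s, d, rfl⟩)

/-- The weighted colimit of a functor with values in Banach spaces. -/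
def colimit (W : Jᵒᵖ ⥤ Ban.{u} 𝕜) (D : J ⥤ Ban.{u} 𝕜) : Ban.{u} 𝕜 :=
  haveI : CompleteSpace (evalSpan W D).topologicalClosure :=
    (Submodule.isClosed_topologicalClosure _).completeSpace_coe
  ⟨(evalSpan W D).topologicalClosure⟩

/-- The colimit cocone. -/
def colimitInj (W : Jᵒᵖ ⥤ Ban.{u} 𝕜) (D : J ⥤ Ban.{u} 𝕜) (j : J) (s : W.obj (op j)) :
    D.obj j ⟶ colimit W D :=
  (dualEval W D j s).codRestrict (evalSpan W D).topologicalClosure (dualEval_mem j s)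

/-- The hypothesis says that the two bounded maps agree on the evaluations, hence on their span,
which is dense in its closure. -/
theorem colimit_hom_ext {b : Ban.{u} 𝕜} {h h' : colimit W D ⟶ b}
    (hh : ∀ j s, colimitInj W D j s ≫ h = colimitInj W D j s ≫ h') : h = h' := by
  let k : (evalSpan W D).topologicalClosure →L[𝕜] b := h
  let k' : (evalSpan W D).topologicalClosure →L[𝕜] b := h'
  suffices hk : k = k' from hk
  have hd : DenseRange (Set.inclusion (Submodule.le_topologicalClosure (evalSpan W D))) :=
    denseRange_inclusion_iff _ |>.2 (le_of_eq (Submodule.topologicalClosure_coe _))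
  refine ContinuousLinearMap.ext fun v =>
    congrFun (hd.equalizer k.continuous k'.continuous (funext fun v => ?_)) v
  obtain ⟨v, hv⟩ := v
  change k ⟨v, _⟩ = k' ⟨v, _⟩
  induction hv using Submodule.span_induction with
  | mem v hv =>
    obtain ⟨j, s, d, rfl⟩ := hv
    exact DFunLike.congr_fun (show (toCLM (colimitInj W D j s ≫ h)) =
      toCLM (colimitInj W D j s ≫ h') from hh j s) d
  | zero => exact k.map_zero.trans k'.map_zero.symm
  | add v v' hv hv' e e' =>
    exact (k.map_add ⟨v, Submodule.le_topologicalClosure _ hv⟩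
      ⟨v', Submodule.le_topologicalClosure _ hv'⟩).trans
      ((congrArg₂ (· + ·) e e').trans (k'.map_add ⟨v, Submodule.le_topologicalClosure _ hv⟩
      ⟨v', Submodule.le_topologicalClosure _ hv'⟩).symm)
  | smul r v hv e =>
    exact (k.map_smul r ⟨v, Submodule.le_topologicalClosure _ hv⟩).trans
      ((congrArg (r • ·) e).trans (k'.map_smul r ⟨v, Submodule.le_topologicalClosure _ hv⟩).symm)

/-! ### Factoring a cocone through the colimit by means of the double dual. -/

section Desc

variable {b : Ban.{u} 𝕜} {C : ℝ} {φ : ∀ j, W.obj (op j) → (D.obj j ⟶ b)}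

/-- The component of a cocone as a bounded bilinear map. -/
def coconeCLM (hφ : IsCocone W D b C φ) (j : J) : W.obj (op j) →L[𝕜] D.obj j →L[𝕜] b :=
  LinearMap.mkContinuous
    { toFun := fun s => toCLM (φ j s)
      map_add' := hφ.map_add j
      map_smul' := hφ.map_smul j } C (hφ.norm_le j)

/-- Composition of a cocone with a functional is a scalar cocone. -/
def coconeDual (hC : 0 ≤ C) (hφ : IsCocone W D b C φ) :
    StrongDual 𝕜 b →L[𝕜] Cocones W D :=
  have hn : ∀ (f : StrongDual 𝕜 b) (j : J),
      ‖(ContinuousLinearMap.compL 𝕜 (D.obj j) b 𝕜 f).comp (coconeCLM hφ j)‖ ≤ C * ‖f‖ :=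
    fun f j => (ContinuousLinearMap.opNorm_comp_le _ _).trans ((mul_comm _ _).trans_le
      (mul_le_mul (LinearMap.mkContinuous_norm_le _ hC _)
        (((ContinuousLinearMap.compL 𝕜 (D.obj j) b 𝕜).le_opNorm f).trans
          (mul_le_of_le_one_left (norm_nonneg _) (ContinuousLinearMap.norm_compL_le _ _ _ _)))
        (norm_nonneg _) hC))
  LinearMap.mkContinuous
    { toFun := fun f => Cocones.mk (fun j =>
          (ContinuousLinearMap.compL 𝕜 (D.obj j) b 𝕜 f).comp (coconeCLM hφ j)) (C * ‖f‖) (hn f)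
        fun g s d => congrArg f (DFunLike.congr_fun (congrArg toCLM (hφ.natural g s)) d)
      map_add' := fun _ _ => rfl
      map_smul' := fun _ _ => rfl } C
    (fun f => Cocones.norm_le (mul_nonneg hC (norm_nonneg f)) (hn f))

theorem norm_coconeDual_le (hC : 0 ≤ C) (hφ : IsCocone W D b C φ) : ‖coconeDual hC hφ‖ ≤ C := by
  unfold coconeDual
  exact LinearMap.mkContinuous_norm_le _ hC _

/-- Composing `φ` with functionals sends the dual of `b` to scalar cocones; the transpose of this
map goes from the dual of the scalar cocones to the double dual of `b` with norm at most `C`. It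
sends each evaluation at `(s, d)` to the canonical image of `φ j s d`. Since `b` is complete and
embeds isometrically in its double dual, its image is closed, so the closed span of the evaluations
lands in `b`. -/
theorem exists_colimitDesc (hC : 0 ≤ C) (hφ : IsCocone W D b C φ) :
    ∃ h : colimit W D ⟶ b, ‖h‖ ≤ C ∧ ∀ j s, colimitInj W D j s ≫ h = φ j s := by
  -- Flipping composition yields `Ψ Λ = Λ ∘ coconeDual`.
  let Ψ : StrongDual 𝕜 (Cocones W D) →L[𝕜] StrongDual 𝕜 (StrongDual 𝕜 b) :=
    (ContinuousLinearMap.compL 𝕜 (StrongDual 𝕜 b) (Cocones W D) 𝕜).flip (coconeDual hC hφ)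
  have hΨ : ∀ Λ, ‖Ψ Λ‖ ≤ C * ‖Λ‖ := fun Λ =>
    (ContinuousLinearMap.opNorm_comp_le Λ (coconeDual hC hφ)).trans ((mul_comm _ _).trans_le
      (mul_le_mul_of_nonneg_right (norm_coconeDual_le hC hφ) (norm_nonneg Λ)))
  let I := NormedSpace.inclusionInDoubleDualLi 𝕜 (E := b)
  have hev : ∀ j s d, Ψ (dualEval W D j s d) = I (toCLM (φ j s) d) := fun j s d => rfl
  have hmem : ∀ Λ ∈ (evalSpan W D).topologicalClosure, Ψ Λ ∈ LinearMap.range I.toLinearMap := by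
    have hcl : IsClosed ((LinearMap.range I.toLinearMap).comap Ψ.toLinearMap :
        Set (StrongDual 𝕜 (Cocones W D))) :=
      (I.isometry.isClosedEmbedding.isClosed_range).preimage Ψ.continuous
    refine Submodule.topologicalClosure_minimal _ (Submodule.span_le.2 ?_) hcl
    rintro _ ⟨j, s, d, rfl⟩
    exact ⟨_, (hev j s d).symm⟩
  let k : (evalSpan W D).topologicalClosure →L[𝕜] LinearMap.range I.toLinearMap :=
    (Ψ.comp (evalSpan W D).topologicalClosure.subtypeL).codRestrict _ (fun Λ => hmem Λ Λ.2)
  let e := I.equivRange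
  let h : (evalSpan W D).topologicalClosure →L[𝕜] b :=
    e.symm.toContinuousLinearEquiv.toContinuousLinearMap.comp k
  refine ⟨h, ContinuousLinearMap.opNorm_le_bound _ hC fun Λ => ?_, fun j s => ?_⟩
  · exact (e.symm.norm_map (k Λ)).trans_le (hΨ Λ)
  · refine ContinuousLinearMap.ext fun d => ?_
    exact e.symm_apply_eq.2 (Subtype.ext (hev j s d))

end Desc

/-- The naturality imposed on scalar cocones is exactly what makes the evaluations a cocone. -/
theorem isWeightedColimit_colimit (W : Jᵒᵖ ⥤ Ban.{u} 𝕜) (D : J ⥤ Ban.{u} 𝕜) [HomNormed J]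
    [BanachCategory 𝕜 J] : IsWeightedColimit W D (colimit W D) (colimitInj W D) where
  isCocone :=
    { map_add := fun j s t => ContinuousLinearMap.ext fun d => Subtype.ext
        (DFunLike.congr_fun ((dualEval W D j).map_add s t) d)
      map_smul := fun j r s => ContinuousLinearMap.ext fun d => Subtype.ext
        (DFunLike.congr_fun ((dualEval W D j).map_smul r s) d)
      norm_le := fun j s => by
        rw [one_mul]
        exact ContinuousLinearMap.opNorm_le_bound _ (norm_nonneg s) fun d =>
          (dualEval W D j s).le_of_opNorm_le (norm_dualEval_apply_le j s) d
      natural := fun f s => ContinuousLinearMap.ext fun d => Subtype.ext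
        (ContinuousLinearMap.ext fun β => β.natural f s d) }
  desc _ _ _ hC hφ := exists_colimitDesc hC hφ
  uniq _ _ _ hh := colimit_hom_ext hh

end Ban

/-! ### Bounded natural transformations -/

namespace FunCat

variable {𝕜 : Type} [RCLike 𝕜] {C : Type v} [Category.{w} C] {A : Type v₁} [Category.{w₁} A]
  [HomNormed A] [BanachCategory 𝕜 A] {P : (C ⥤ A) → Prop}

/-- A bounded natural family as a morphism in the category of functors. -/
def homMk {F G : FunCat 𝕜 P} (τ : ∀ a, F.obj.obj a ⟶ G.obj.obj a) (K : ℝ) (hK : ∀ a, ‖τ a‖ ≤ K)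
    (hn : ∀ ⦃a b : C⦄ (f : a ⟶ b), F.obj.map f ≫ τ b = τ a ≫ G.obj.map f) : F ⟶ G :=
  mkNat τ K hK hn

theorem hom_ext {F G : FunCat 𝕜 P} {σ τ : F ⟶ G} (h : ∀ a, app σ a = app τ a) : σ = τ :=
  Subtype.ext (lp.ext (funext h))

theorem naturality {F G : FunCat 𝕜 P} (τ : F ⟶ G) {a b : C} (f : a ⟶ b) :
    F.obj.map f ≫ app τ b = app τ a ≫ G.obj.map f :=
  (show boundedNat 𝕜 F.obj G.obj from τ).2 f

theorem norm_app_le {F G : FunCat 𝕜 P} (τ : F ⟶ G) (a : C) : ‖app τ a‖ ≤ ‖τ‖ :=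
  lp.norm_apply_le_norm ENNReal.top_ne_zero (show boundedNat 𝕜 F.obj G.obj from τ).1 a

theorem norm_le {F G : FunCat 𝕜 P} {τ : F ⟶ G} {K : ℝ} (hK : 0 ≤ K) (h : ∀ a, ‖app τ a‖ ≤ K) :
    ‖τ‖ ≤ K :=
  lp.norm_le_of_forall_le hK h

variable (𝕜 P) in
/-- Evaluation at an object. -/
def eval (a : C) : FunCat 𝕜 P ⥤ A where
  obj F := F.obj.obj a
  map τ := app τ a

theorem isBanachFunctor_precomp {C' : Type v₂} [Category.{w₂} C'] {Q : (C' ⥤ A) → Prop}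
    (K : C' ⥤ C) (h : ∀ F : C ⥤ A, P F → Q (K ⋙ F)) :
    IsBanachFunctor 𝕜 (precomp K h : FunCat 𝕜 P ⥤ FunCat 𝕜 Q) where
  map_add _ _ := rfl
  map_smul _ _ := rfl
  norm_map_le τ := norm_le (norm_nonneg τ) fun a => norm_app_le τ (K.obj a)

end FunCat

namespace Bundle

variable {𝕜 : Type} [RCLike 𝕜] {X : Type u}

theorem norm_app_le {ξ ζ : Bundle.{u} 𝕜 X} (τ : ξ ⟶ ζ) (x : X) : ‖app τ x‖ ≤ ‖τ‖ :=
  lp.norm_apply_le_norm ENNReal.top_ne_zero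
    (show lp (fun x => ξ.fiber x ⟶ ζ.fiber x) ∞ from τ) x

theorem norm_le {ξ ζ : Bundle.{u} 𝕜 X} {τ : ξ ⟶ ζ} {K : ℝ} (hK : 0 ≤ K)
    (h : ∀ x, ‖app τ x‖ ≤ K) : ‖τ‖ ≤ K :=
  lp.norm_le_of_forall_le hK h

end Bundle

/-! ### Presheaves on a discrete category -/

namespace PShv

variable {𝕜 : Type} [RCLike 𝕜] {X : Type u}

/-- The fiber of a presheaf over a point. -/
abbrev fiber (ξ : PShv.{u} 𝕜 X) (x : X) : Ban.{u} 𝕜 := ξ.obj.obj (op ⟨x⟩)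

/-- The component of a morphism of presheaves at a point. -/
abbrev appAt {ξ ζ : PShv.{u} 𝕜 X} (τ : ξ ⟶ ζ) (x : X) : ξ.fiber x ⟶ ζ.fiber x :=
  FunCat.app τ (op ⟨x⟩)

theorem discrete_op_naturality {A : Type v} [Category.{w} A] {F G : (Discrete X)ᵒᵖ ⥤ A}
    (τ : ∀ a, F.obj a ⟶ G.obj a) {a b : (Discrete X)ᵒᵖ} (f : a ⟶ b) :
    F.map f ≫ τ b = τ a ≫ G.map f := by
  obtain ⟨⟨x⟩⟩ := a
  obtain ⟨⟨y⟩⟩ := b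
  obtain rfl : y = x := Discrete.eq_of_hom f.unop
  rw [show f = 𝟙 _ from Quiver.Hom.unop_inj (Subsingleton.elim _ _), F.map_id, G.map_id,
    Category.id_comp, Category.comp_id]

/-- A bounded family of maps between the fibers, as a morphism of presheaves. -/
def homMk {ξ ζ : PShv.{u} 𝕜 X} (τ : ∀ x, ξ.fiber x ⟶ ζ.fiber x) (K : ℝ)
    (hK : ∀ x, ‖τ x‖ ≤ K) : ξ ⟶ ζ :=
  FunCat.homMk (fun a => τ a.unop.as) K (fun a => hK a.unop.as)
    (fun _ _ f => discrete_op_naturality (F := ξ.obj) (G := ζ.obj) (fun a => τ a.unop.as) f)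

theorem hom_ext {ξ ζ : PShv.{u} 𝕜 X} {σ τ : ξ ⟶ ζ} (h : ∀ x, appAt σ x = appAt τ x) : σ = τ :=
  FunCat.hom_ext fun a => h a.unop.as

theorem norm_le {ξ ζ : PShv.{u} 𝕜 X} {τ : ξ ⟶ ζ} {K : ℝ} (hK : 0 ≤ K)
    (h : ∀ x, ‖appAt τ x‖ ≤ K) : ‖τ‖ ≤ K :=
  FunCat.norm_le hK fun a => h a.unop.as

/-- The presheaf with given fibers. -/
abbrev ofFibers (V : X → Ban.{u} 𝕜) : PShv.{u} 𝕜 X := (bundleToPShv 𝕜 X).obj ⟨V⟩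

/-- Weighted colimits of presheaves are computed fiberwise. -/
theorem isWeightedColimit_ofFibers {J : Type u} [Category.{u} J] [HomNormed J]
    [BanachCategory 𝕜 J] {W : Jᵒᵖ ⥤ Ban.{u} 𝕜} {D : J ⥤ PShv.{u} 𝕜 X} {c : X → Ban.{u} 𝕜}
    {inj : ∀ x j, W.obj (op j) → ((D.obj j).fiber x ⟶ c x)}
    (hcol : ∀ x, IsWeightedColimit W (D ⋙ FunCat.eval 𝕜 _ (op ⟨x⟩)) (c x) (inj x))
    (hle : ∀ j s x, ‖inj x j s‖ ≤ ‖s‖) :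
    IsWeightedColimit W D (ofFibers c) (fun j s => homMk (fun x => inj x j s) ‖s‖ (hle j s)) where
  isCocone :=
    { map_add := fun j s t => hom_ext fun x => (hcol x).isCocone.map_add j s t
      map_smul := fun j r s => hom_ext fun x => (hcol x).isCocone.map_smul j r s
      norm_le := fun j s => (norm_le (norm_nonneg s) (hle j s)).trans_eq (one_mul _).symm
      natural := fun f s => hom_ext fun x => (hcol x).isCocone.natural f s }
  desc b φ C hC hφ := by
    have hx : ∀ x, IsCocone W (D ⋙ FunCat.eval 𝕜 _ (op ⟨x⟩)) (b.fiber x) C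
        (fun j s => appAt (φ j s) x) := fun x =>
      { map_add := fun j s t => congrArg (appAt · x) (hφ.map_add j s t)
        map_smul := fun j r s => congrArg (appAt · x) (hφ.map_smul j r s)
        norm_le := fun j s => (FunCat.norm_app_le _ _).trans (hφ.norm_le j s)
        natural := fun f s => congrArg (appAt · x) (hφ.natural f s) }
    -- The fiberwise factorizations share the bound `C`, so together they are a bounded family of
    -- norm at most `C`.
    choose h hn hh using fun x => (hcol x).desc _ _ C hC (hx x)
    exact ⟨homMk h C hn, norm_le hC hn, fun j s => hom_ext fun x => hh x j s⟩
  uniq b h h' hh :=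
    hom_ext fun x => (hcol x).uniq _ _ _ fun j s => congrArg (appAt · x) (hh j s)

theorem isBanachTwoSpace : IsBanachTwoSpace 𝕜 (PShv.{u} 𝕜 X) := by
  intro J _ _ _ W D _ _
  have hcol := fun x => Ban.isWeightedColimit_colimit W (D ⋙ FunCat.eval 𝕜 _ (op ⟨x⟩))
  exact ⟨_, _, isWeightedColimit_ofFibers hcol fun j s x =>
    ((hcol x).isCocone.norm_le j s).trans_eq (one_mul _)⟩

end PShv

/-! ### Presheaves and bundles -/

section BundlePShv

variable {𝕜 : Type} [RCLike 𝕜] {X : Type u}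

theorem isIsometricFF_bundleToPShv : IsIsometricFF 𝕜 (bundleToPShv.{u} 𝕜 X) where
  isBanachFunctor :=
    { map_add := fun _ _ => rfl
      map_smul := fun _ _ => rfl
      norm_map_le := fun τ => PShv.norm_le (norm_nonneg τ) (Bundle.norm_app_le τ) }
  norm_map τ := le_antisymm (PShv.norm_le (norm_nonneg τ) (Bundle.norm_app_le τ))
    (Bundle.norm_le (norm_nonneg _) fun x =>
      FunCat.norm_app_le ((bundleToPShv 𝕜 X).map τ) (op ⟨x⟩))
  surjective _ _ τ := ⟨Bundle.mkHom (fun x => PShv.appAt τ x) ‖τ‖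
    (fun x => FunCat.norm_app_le τ (op ⟨x⟩)), PShv.hom_ext fun _ => rfl⟩

/-- The only morphisms of a discrete category are identities, so a presheaf equals, as a functor,
the one built from its own fibers. -/
theorem bijective_bundleToPShv_obj : Function.Bijective (bundleToPShv.{u} 𝕜 X).obj := by
  constructor
  · rintro ⟨V⟩ ⟨V'⟩ h
    exact congrArg Bundle.mk (funext fun x => congrArg (fun ξ => PShv.fiber ξ x) h)
  · rintro ⟨F, hF⟩
    refine ⟨⟨fun x => F.obj (op ⟨x⟩)⟩, ?_⟩
    have h : (Discrete.opposite X).functor ⋙ Discrete.functor (fun x => F.obj (op ⟨x⟩)) = F := by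
      refine CategoryTheory.Functor.ext (fun _ => rfl) fun a b f => ?_
      obtain ⟨⟨x⟩⟩ := a
      obtain ⟨⟨y⟩⟩ := b
      obtain rfl : y = x := Discrete.eq_of_hom f.unop
      rw [show f = 𝟙 _ from Quiver.Hom.unop_inj (Subsingleton.elim _ _)]
      rw [CategoryTheory.Functor.map_id, CategoryTheory.Functor.map_id]
      exact (Category.id_comp _).symm
    simp only [bundleToPShv, h]

end BundlePShv

end

noncomputable section

open BanachCategory

/-! ### Coproducts and sums of tensors -/

section Coproduct

variable {A : Type v} [Category.{w} A] [HomNormed A]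

/-- By uniqueness, `k` is the factorization that `desc` supplies for its own components, and so
inherits its bound. This is the isometric half of the universal property. -/
theorem IsCoproduct.norm_le_of_comp {ι : Type v₁} {a : ι → A} {c : A} {inj : ∀ j, a j ⟶ c}
    (h : IsCoproduct a c inj) {b : A} {k : c ⟶ b} {C : ℝ} (hC : 0 ≤ C)
    (hk : ∀ j, ‖inj j ≫ k‖ ≤ C) : ‖k‖ ≤ C := by
  obtain ⟨k', hk', e⟩ := h.desc b (fun j => inj j ≫ k) C hC hk
  rwa [h.uniq b k k' fun j => (e j).symm]

theorem IsCoproduct.reindex {ι : Type v₁} {κ : Type v₂} (e : ι ≃ κ) {a : κ → A} {c : A}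
    {inj : ∀ j, a j ⟶ c} (h : IsCoproduct a c inj) :
    IsCoproduct (fun i => a (e i)) c (fun i => inj (e i)) where
  norm_le i := h.norm_le (e i)
  desc b f C hC hf := by
    have hf' : ∀ i, Equiv.piCongrLeft (fun k => a k ⟶ b) e f (e i) = f i :=
      Equiv.piCongrLeft_apply_apply (fun k => a k ⟶ b) e f
    obtain ⟨k, hk, hk'⟩ := h.desc b (Equiv.piCongrLeft (fun k => a k ⟶ b) e f) C hC fun j => by
      obtain ⟨i, rfl⟩ := e.surjective j
      rw [hf']
      exact hf i
    exact ⟨k, hk, fun i => (hk' (e i)).trans (hf' i)⟩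
  uniq b k k' hk := h.uniq b k k' fun j => by
    obtain ⟨i, rfl⟩ := e.surjective j
    exact hk i

theorem IsTensorSum.norm_le_of_comp {𝕜 : Type} [RCLike 𝕜] [BanachCategory 𝕜 A] {ι : Type v₂}
    {V : ι → Ban.{u} 𝕜} {a : ι → A} {c : A} {inj : ∀ i, V i →L[𝕜] (a i ⟶ c)}
    (h : IsTensorSum V a c inj) {b : A} {k : c ⟶ b} {C : ℝ} (hC : 0 ≤ C)
    (hk : ∀ i s, ‖inj i s ≫ k‖ ≤ C * ‖s‖) : ‖k‖ ≤ C := by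
  obtain ⟨k', hk', e⟩ := h.desc b (fun i => (postcompL 𝕜 (a i) k).comp (inj i)) C hC fun i =>
    ContinuousLinearMap.opNorm_le_bound _ hC (hk i)
  rwa [h.uniq b k k' fun i s => (e i s).symm]

end Coproduct

/-! ### Cosheaves and their restriction to atoms -/

section Atoms

variable {X : Type u}

/-- The partition of a set into singletons. -/
def singletonPartition (E : Set X) : Partition E where
  parts := (fun x => ({x} : Set X)) '' E
  sSupIndep' := by
    rintro _ ⟨x, -, rfl⟩
    refine Set.disjoint_singleton_left.2 ?_
    rintro ⟨_, ⟨⟨y, -, rfl⟩, hy⟩, hxy⟩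
    exact hy (congrArg _ (Set.mem_singleton_iff.1 hxy).symm)
  bot_notMem' := by
    rintro ⟨x, -, hx⟩
    exact Set.singleton_ne_empty x hx
  sSup_eq' := by
    rw [Set.sSup_eq_sUnion, Set.sUnion_image, Set.biUnion_of_singleton]

theorem Partition.exists_mem_of_mem {E : Set X} (𝓔 : Partition E) {x : X} (hx : x ∈ E) :
    ∃ F : (𝓔 : Set (Set X)), x ∈ F.1 := by
  rw [← 𝓔.sSup_eq] at hx
  obtain ⟨F, hF, hxF⟩ := hx
  exact ⟨⟨F, hF⟩, hxF⟩

theorem Partition.part_eq_of_mem {E : Set X} (𝓔 : Partition E) {x : X}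
    {F G : (𝓔 : Set (Set X))} (hF : x ∈ F.1) (hG : x ∈ G.1) : F = G :=
  Subtype.ext (𝓔.eq_of_not_disjoint F.2 G.2 fun h => Set.disjoint_left.1 h hF hG)

variable {A : Type v} [Category.{w} A]

theorem map_homOfLE_self {μ : Set X ⥤ A} {E : Set X} (h : E ≤ E) :
    μ.map (homOfLE h) = 𝟙 (μ.obj E) :=
  (congrArg μ.map (Subsingleton.elim _ _)).trans (μ.map_id E)

theorem map_homOfLE_comp {μ : Set X ⥤ A} {E F G : Set X} (h : E ≤ F) (f : F ⟶ G) :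
    μ.map (homOfLE h) ≫ μ.map f = μ.map (homOfLE (h.trans (leOfHom f))) :=
  (μ.map_comp _ _).symm.trans (congrArg μ.map (Subsingleton.elim _ _))

theorem singleton_le_of_mem {E : Set X} {x : X} (hx : x ∈ E) : ({x} : Set X) ≤ E :=
  Set.singleton_subset_iff.2 hx

variable [HomNormed A] [Countable X]

/-- The value of a cosheaf at `E` is the coproduct of its values at the points of `E`. -/
theorem IsCosheaf.isCoproduct_atoms {μ : Set X ⥤ A} (hμ : IsCosheaf μ) (E : Set X) :
    IsCoproduct (fun x : E => μ.obj {x.1}) (μ.obj E)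
      (fun x => μ.map (homOfLE (singleton_le_of_mem x.2))) :=
  (hμ.isSigmaAdditive E (singletonPartition E) (E.to_countable.image _)).reindex
    (Equiv.Set.image (fun x => ({x} : Set X)) E Set.singleton_injective)

/-- Natural transformations from a cosheaf to a precosheaf agree if they agree on atoms. -/
theorem IsCosheaf.natural_ext {μ : Set X ⥤ A} (hμ : IsCosheaf μ) {G : Set X ⥤ A}
    {σ τ : ∀ E, μ.obj E ⟶ G.obj E}
    (hσ : ∀ ⦃E F : Set X⦄ (f : E ⟶ F), μ.map f ≫ σ F = σ E ≫ G.map f)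
    (hτ : ∀ ⦃E F : Set X⦄ (f : E ⟶ F), μ.map f ≫ τ F = τ E ≫ G.map f)
    (h : ∀ x, σ {x} = τ {x}) (E : Set X) : σ E = τ E :=
  (hμ.isCoproduct_atoms E).uniq _ _ _ fun x => by rw [hσ, hτ, h]

/-- A natural transformation from a cosheaf to a precosheaf is bounded by its norms on atoms. -/
theorem IsCosheaf.norm_natural_le (𝕜 : Type) [RCLike 𝕜] [BanachCategory 𝕜 A]
    {μ : Set X ⥤ A} (hμ : IsCosheaf μ) {G : Set X ⥤ A}
    (hG : IsContractive G) {σ : ∀ E, μ.obj E ⟶ G.obj E}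
    (hσ : ∀ ⦃E F : Set X⦄ (f : E ⟶ F), μ.map f ≫ σ F = σ E ≫ G.map f) {C : ℝ} (hC : 0 ≤ C)
    (h : ∀ x, ‖σ {x}‖ ≤ C) (E : Set X) : ‖σ E‖ ≤ C :=
  (hμ.isCoproduct_atoms E).norm_le_of_comp hC fun x => by
    rw [hσ]
    exact norm_comp_le_of_le' 𝕜 (h x) (hG _)

/-- A bounded family on the atoms extends to a natural transformation from a cosheaf to a
precosheaf. -/
theorem IsCosheaf.exists_natural (𝕜 : Type) [RCLike 𝕜] [BanachCategory 𝕜 A]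
    {μ : Set X ⥤ A} (hμ : IsCosheaf μ) {G : Set X ⥤ A}
    (hG : IsContractive G) (g : ∀ x : X, μ.obj {x} ⟶ G.obj {x}) {C : ℝ} (hC : 0 ≤ C)
    (hg : ∀ x, ‖g x‖ ≤ C) :
    ∃ τ : ∀ E, μ.obj E ⟶ G.obj E, (∀ E, ‖τ E‖ ≤ C) ∧
      (∀ ⦃E F : Set X⦄ (f : E ⟶ F), μ.map f ≫ τ F = τ E ≫ G.map f) ∧ ∀ x, τ {x} = g x := by
  choose τ hn hτ using fun E => (hμ.isCoproduct_atoms E).desc (G.obj E)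
    (fun x => g x.1 ≫ G.map (homOfLE (singleton_le_of_mem x.2))) C hC
    (fun x => norm_comp_le_of_le' 𝕜 (hg x.1) (hG _))
  refine ⟨τ, hn, fun E F f => ?_, fun x => ?_⟩
  · refine (hμ.isCoproduct_atoms E).uniq _ _ _ fun x => ?_
    rw [← Category.assoc, ← Category.assoc, map_homOfLE_comp, hτ E x, Category.assoc,
      map_homOfLE_comp]
    exact hτ F ⟨x.1, leOfHom f x.2⟩
  · have := hτ {x} ⟨x, rfl⟩
    rwa [map_homOfLE_self, map_homOfLE_self, Category.id_comp, Category.comp_id] at this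

/-- Each `μ E` is the coproduct of the atoms in `E`, so a bounded family on atoms extends to a
natural transformation with the same bound, and the norm of a transformation is attained as the
supremum over atoms. -/
theorem isIsometricFF_restrictToAtoms (𝕜 : Type) [RCLike 𝕜] [BanachCategory 𝕜 A] :
    IsIsometricFF 𝕜 (restrictToAtoms 𝕜 X A) where
  isBanachFunctor := FunCat.isBanachFunctor_precomp _ _
  norm_map {μ ν} τ := le_antisymm ((FunCat.isBanachFunctor_precomp _ _).norm_map_le τ)
    (FunCat.norm_le (norm_nonneg _) (IsCosheaf.norm_natural_le 𝕜 μ.property ν.property.isContractive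
      (fun _ _ f => FunCat.naturality τ f) (norm_nonneg _)
      fun x => FunCat.norm_app_le ((restrictToAtoms 𝕜 X A).map τ) ⟨x⟩))
  surjective μ ν σ := by
    obtain ⟨τ, hn, hτ, e⟩ := IsCosheaf.exists_natural 𝕜 μ.property ν.property.isContractive
      (fun x => FunCat.app σ ⟨x⟩) (norm_nonneg σ) (fun x => FunCat.norm_app_le σ ⟨x⟩)
    exact ⟨FunCat.homMk τ ‖σ‖ hn hτ, FunCat.hom_ext fun x => e x.as⟩

end Atoms

/-! ### The cosheaf defined by a family of objects -/

section OfCoproducts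

variable {X : Type u} {A : Type v} [Category.{w} A] [HomNormed A] {a : X → A} {c : Set X → A}
  {inj : ∀ (E : Set X) (x : E), a x ⟶ c E}

theorem exists_map_of_isCoproduct (hc : ∀ E : Set X, IsCoproduct (fun x : E => a x) (c E) (inj E))
    {E F : Set X} (h : E ≤ F) :
    ∃ k : c E ⟶ c F, ‖k‖ ≤ 1 ∧ ∀ x : E, inj E x ≫ k = inj F ⟨x, h x.2⟩ :=
  (hc E).desc (c F) (fun x => inj F ⟨x, h x.2⟩) 1 zero_le_one fun _ => (hc F).norm_le _

/-- The precosheaf whose value at `E` is the coproduct of `a x` over the points `x` of `E`. -/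
def coproductPrecosheaf (hc : ∀ E : Set X, IsCoproduct (fun x : E => a x) (c E) (inj E)) : Set X ⥤ A where
  obj := c
  map f := (exists_map_of_isCoproduct hc (leOfHom f)).choose
  map_id E := (hc E).uniq _ _ _ fun x =>
    ((exists_map_of_isCoproduct hc le_rfl).choose_spec.2 x).trans (Category.comp_id _).symm
  map_comp {E F G} f g := (hc E).uniq _ _ _ fun x => by
    rw [← Category.assoc, (exists_map_of_isCoproduct hc (leOfHom f)).choose_spec.2 x,
      (exists_map_of_isCoproduct hc (leOfHom g)).choose_spec.2]
    exact (exists_map_of_isCoproduct hc (leOfHom (f ≫ g))).choose_spec.2 x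

theorem inj_comp_coproductPrecosheaf_map
    (hc : ∀ E : Set X, IsCoproduct (fun x : E => a x) (c E) (inj E)) {E F : Set X} (f : E ⟶ F) (x : E) :
    inj E x ≫ (coproductPrecosheaf hc).map f = inj F ⟨x, leOfHom f x.2⟩ :=
  (exists_map_of_isCoproduct hc (leOfHom f)).choose_spec.2 x

/-- Associativity of coproducts: each point of `E` lies in exactly one part, so families on the
points of `E` are families on the points of the parts, with the same bound. -/
theorem isCosheaf_coproductPrecosheaf (𝕜 : Type) [RCLike 𝕜] [BanachCategory 𝕜 A]
    (hc : ∀ E : Set X, IsCoproduct (fun x : E => a x) (c E) (inj E)) :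
    IsCosheaf (coproductPrecosheaf hc) where
  isContractive _ _ f := (exists_map_of_isCoproduct hc (leOfHom f)).choose_spec.1
  isSigmaAdditive E 𝓔 _ := by
    choose P hP using fun x : E => 𝓔.exists_mem_of_mem x.2
    refine ⟨fun F => (exists_map_of_isCoproduct hc
      (leOfHom (homOfLE (𝓔.le_of_mem F.2)))).choose_spec.1, fun b f C hC hf => ?_,
      fun b k k' hk => (hc E).uniq _ _ _ fun x => ?_⟩
    · obtain ⟨k, hk, hk'⟩ := (hc E).desc b (fun x => inj (P x).1 ⟨x, hP x⟩ ≫ f (P x)) C hC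
        fun x => norm_comp_le_of_le 𝕜 ((hc _).norm_le _) (hf _)
      -- The component at `x` was defined through the chosen part `P x`; this identifies it with the
      -- one through any part containing `x`, handling the dependence of types on the part.
      have key : ∀ (F G : (𝓔 : Set (Set X))) (x : X) (hF : x ∈ F.1) (hG : x ∈ G.1),
          inj F.1 ⟨x, hF⟩ ≫ f F = inj G.1 ⟨x, hG⟩ ≫ f G := by
        intro F G x hF hG
        obtain rfl := 𝓔.part_eq_of_mem hF hG
        rfl
      refine ⟨k, hk, fun F => (hc F.1).uniq _ _ _ fun x => ?_⟩
      refine (Category.assoc _ _ _).symm.trans ((congrArg (· ≫ k)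
        (inj_comp_coproductPrecosheaf_map hc _ x)).trans ((hk' _).trans (key _ _ _ _ x.2)))
    · have e := inj_comp_coproductPrecosheaf_map hc (homOfLE (𝓔.le_of_mem (P x).2)) ⟨x, hP x⟩
      rw [← e]
      exact (Category.assoc _ _ _).trans ((congrArg (inj (P x).1 ⟨x, hP x⟩ ≫ ·) (hk (P x))).trans
        (Category.assoc _ _ _).symm)

/-- This permits `a x` itself to be chosen as the coproduct over `{x}`, so that restriction to atoms
returns the given object and not merely an isomorphic one. -/
theorem isCoproduct_singleton {𝕜 : Type} [RCLike 𝕜] [BanachCategory 𝕜 A] (a : X → A) (x : X) :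
    IsCoproduct (fun y : ({x} : Set X) => a y) (a x)
      (fun y => eqToHom (congrArg a (Set.mem_singleton_iff.1 y.2))) where
  norm_le := by
    rintro ⟨y, hy⟩
    obtain rfl := Set.mem_singleton_iff.1 hy
    exact norm_id_le (𝕜 := 𝕜) _
  desc b f C _ hf := by
    refine ⟨f ⟨x, rfl⟩, hf _, ?_⟩
    rintro ⟨y, hy⟩
    obtain rfl := Set.mem_singleton_iff.1 hy
    exact Category.id_comp _
  uniq b k k' hk := (Category.id_comp k).symm.trans ((hk ⟨x, rfl⟩).trans (Category.id_comp k'))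

end OfCoproducts

theorem discreteFunctor_ext {X : Type u} {A : Type v} [Category.{w} A] {F G : Discrete X ⥤ A}
    (h : ∀ x, F.obj ⟨x⟩ = G.obj ⟨x⟩) : F = G := by
  refine CategoryTheory.Functor.ext (fun x => h x.as) ?_
  rintro ⟨x⟩ ⟨y⟩ f
  obtain rfl : x = y := Discrete.eq_of_hom f
  rw [show f = 𝟙 _ from Subsingleton.elim _ _, CategoryTheory.Functor.map_id,
    CategoryTheory.Functor.map_id, Category.id_comp, eqToHom_trans, eqToHom_refl]

/-- The cosheaf is assembled from coproducts over all subsets. Strict equality with `F` needs only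
equality on objects, because functors on a discrete category have no further data. -/
theorem surjective_restrictToAtoms_obj {𝕜 : Type} [RCLike 𝕜] {X : Type u} {A : Type v}
    [Category.{u} A] [HomNormed A] [BanachCategory 𝕜 A] (hA : IsBanachTwoSpace 𝕜 A) :
    Function.Surjective (restrictToAtoms 𝕜 X A).obj := by
  rintro ⟨F, hF⟩
  have hex : ∀ E : Set X, ∃ (c : A) (inj : ∀ x : E, F.obj ⟨x⟩ ⟶ c),
      IsCoproduct (fun x : E => F.obj ⟨x⟩) c inj ∧ ∀ x, E = {x} → c = F.obj ⟨x⟩ := by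
    intro E
    -- Singletons receive the tautological coproduct; every other set receives an arbitrary one.
    by_cases h : ∃ x, E = {x}
    · obtain ⟨x, rfl⟩ := h
      refine ⟨_, _, isCoproduct_singleton (𝕜 := 𝕜) (fun x => F.obj ⟨x⟩) x, fun y hy => ?_⟩
      rw [Set.singleton_eq_singleton_iff.1 hy]
    · obtain ⟨c, inj, hc⟩ := hA.exists_isCoproduct (fun x : E => F.obj ⟨x.1⟩)
      exact ⟨c, inj, hc, fun x hx => absurd ⟨x, hx⟩ h⟩
  choose c inj hc hs using hex
  refine ⟨⟨coproductPrecosheaf (a := fun x => F.obj ⟨x⟩) hc,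
    isCosheaf_coproductPrecosheaf 𝕜 _⟩, ?_⟩
  have h : atoms X ⋙ coproductPrecosheaf (a := fun x => F.obj ⟨x⟩) hc = F :=
    discreteFunctor_ext fun x => hs {x} x rfl
  simp only [restrictToAtoms, FunCat.precomp, h]

end

noncomputable section

open BanachCategory

/-! ### Characteristic presheaves -/

namespace PShv

variable {𝕜 : Type} [RCLike 𝕜] {X : Type u}

/-- The element `1` of the fiber of `χ E` over a point of `E`. -/
def unit (𝕜 : Type) [RCLike 𝕜] {E : Set X} {x : X} (h : x ∈ E) :
    ((universalCosheaf.{u} 𝕜 X).obj E).fiber x := charFiberOne 𝕜 h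

theorem norm_unit {E : Set X} {x : X} (h : x ∈ E) : ‖unit 𝕜 h‖ = 1 := norm_charFiberOne h

/-- The scalar by which an element of a fiber of `χ E` is a multiple of `1`. -/
def scalar {E : Set X} {x : X} (t : ((universalCosheaf.{u} 𝕜 X).obj E).fiber x) : 𝕜 :=
  (show charFiber 𝕜 E x from t).1.down

theorem eq_scalar_smul_unit {E : Set X} {x : X} (h : x ∈ E)
    (t : ((universalCosheaf.{u} 𝕜 X).obj E).fiber x) : t = scalar t • unit 𝕜 h :=
  eq_smul_charFiberOne h t

theorem eq_zero_of_notMem {E : Set X} {x : X} (h : x ∉ E)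
    (t : ((universalCosheaf.{u} 𝕜 X).obj E).fiber x) : t = 0 :=
  charFiber_eq_zero h t

/-- The bounded linear map `t ↦ t • v` on a fiber of `χ E`. -/
def fiberMap (E : Set X) (x : X) {V : Type w} [NormedAddCommGroup V] [NormedSpace 𝕜 V] (v : V) :
    ((universalCosheaf.{u} 𝕜 X).obj E).fiber x →L[𝕜] V :=
  (scalarMap.{u} 𝕜 v).comp (charFiber 𝕜 E x).subtypeL

theorem fiberMap_unit {E : Set X} {x : X} (h : x ∈ E) {V : Type w} [NormedAddCommGroup V]
    [NormedSpace 𝕜 V] (v : V) : fiberMap E x v (unit 𝕜 h) = v := one_smul 𝕜 v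

theorem norm_fiberMap_le (E : Set X) (x : X) {V : Type w} [NormedAddCommGroup V]
    [NormedSpace 𝕜 V] (v : V) : ‖fiberMap (𝕜 := 𝕜) E x v‖ ≤ ‖v‖ :=
  ContinuousLinearMap.opNorm_le_bound _ (norm_nonneg v) fun t =>
    (norm_smul (scalar t) v).trans_le (mul_comm _ _).le

/-- A morphism out of `χ E` from a bounded section. -/
def homOfSection (E : Set X) {ξ : PShv.{u} 𝕜 X} (v : ∀ x, ξ.fiber x) (C : ℝ)
    (hv : ∀ x, ‖v x‖ ≤ C) : (universalCosheaf.{u} 𝕜 X).obj E ⟶ ξ :=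
  homMk (fun x => fiberMap E x (v x)) C fun x => (norm_fiberMap_le E x (v x)).trans (hv x)

theorem homOfSection_unit {E : Set X} {ξ : PShv.{u} 𝕜 X} {v : ∀ x, ξ.fiber x} {C : ℝ}
    {hv : ∀ x, ‖v x‖ ≤ C} {x : X} (h : x ∈ E) :
    Ban.toCLM (appAt (homOfSection E v C hv) x) (unit 𝕜 h) = v x := fiberMap_unit h (v x)

theorem norm_homOfSection_le {E : Set X} {ξ : PShv.{u} 𝕜 X} {v : ∀ x, ξ.fiber x} {C : ℝ}
    (hC : 0 ≤ C) {hv : ∀ x, ‖v x‖ ≤ C} : ‖homOfSection E v C hv‖ ≤ C :=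
  norm_le hC fun x => (norm_fiberMap_le E x (v x)).trans (hv x)

/-- Each fiber of `χ E` is spanned by `1` over the points of `E` and vanishes elsewhere, so a
morphism out of `χ E` is a bounded section over `E`. -/
theorem charHom_ext {E : Set X} {ξ : PShv.{u} 𝕜 X} {h h' : (universalCosheaf.{u} 𝕜 X).obj E ⟶ ξ}
    (hh : ∀ x (hx : x ∈ E), Ban.toCLM (appAt h x) (unit 𝕜 hx) =
      Ban.toCLM (appAt h' x) (unit 𝕜 hx)) : h = h' := by
  refine hom_ext fun x => ContinuousLinearMap.ext fun t => ?_
  change Ban.toCLM (appAt h x) t = Ban.toCLM (appAt h' x) t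
  by_cases hx : x ∈ E
  · rw [eq_scalar_smul_unit hx t, map_smul, map_smul, hh x hx]
  · rw [eq_zero_of_notMem hx t, map_zero, map_zero]

theorem norm_appAt_unit_le {E : Set X} {ξ : PShv.{u} 𝕜 X}
    (f : (universalCosheaf.{u} 𝕜 X).obj E ⟶ ξ) {x : X} (hx : x ∈ E) :
    ‖Ban.toCLM (appAt f x) (unit 𝕜 hx)‖ ≤ ‖f‖ :=
  ((Ban.toCLM (appAt f x)).le_of_opNorm_le (FunCat.norm_app_le f _) _).trans_eq
    ((congrArg (‖f‖ * ·) (norm_unit hx)).trans (mul_one _))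

-- Morphisms from `χ E` to `b` are bounded sections of `b` over `E`, and such sections are glued
-- uniquely from sections over the parts with a common bound.
open Classical in
theorem isCosheaf_universalCosheaf : IsCosheaf (universalCosheaf.{u} 𝕜 X) where
  isContractive := isContractive_universalCosheaf 𝕜 X
  isSigmaAdditive E 𝓔 _ := by
    choose P hP using fun x : E => 𝓔.exists_mem_of_mem x.2
    refine ⟨fun F => isContractive_universalCosheaf 𝕜 X _, fun b f C hC hf => ?_,
      fun b k k' hk => charHom_ext fun x hx => ?_⟩
    · let v : ∀ x, b.fiber x := fun x => if hx : x ∈ E then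
        Ban.toCLM (appAt (f (P ⟨x, hx⟩)) x) (unit 𝕜 (hP ⟨x, hx⟩)) else 0
      have hv : ∀ x, ‖v x‖ ≤ C := fun x => by
        by_cases hx : x ∈ E
        · simp only [v, dif_pos hx]
          exact (norm_appAt_unit_le _ _).trans (hf _)
        · simp only [v, dif_neg hx]
          rwa [norm_zero]
      have key : ∀ (F G : (𝓔 : Set (Set X))) (x : X) (hF : x ∈ F.1) (hG : x ∈ G.1),
          Ban.toCLM (appAt (f F) x) (unit 𝕜 hF) = Ban.toCLM (appAt (f G) x) (unit 𝕜 hG) := by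
        intro F G x hF hG
        obtain rfl := 𝓔.part_eq_of_mem hF hG
        rfl
      refine ⟨homOfSection E v C hv, norm_homOfSection_le hC, fun F => charHom_ext fun x hx => ?_⟩
      have hxE : x ∈ E := 𝓔.le_of_mem F.2 hx
      refine (homOfSection_unit (hv := hv) hxE).trans ?_
      simp only [v, dif_pos hxE]
      exact key _ _ _ _ _
    · exact DFunLike.congr_fun (congrArg (fun h => Ban.toCLM (appAt h x)) (hk (P ⟨x, hx⟩)))
        (unit 𝕜 (hP ⟨x, hx⟩))

/-! ### Every presheaf is a sum of tensors of Dirac presheaves -/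

/-- The Dirac presheaf at a point. -/
abbrev dirac (𝕜 : Type) [RCLike 𝕜] {X : Type u} (x : X) : PShv.{u} 𝕜 X :=
  (universalCosheaf.{u} 𝕜 X).obj {x}

/-- The element `1` of the fiber of the Dirac presheaf. -/
abbrev one (𝕜 : Type) [RCLike 𝕜] {X : Type u} (x : X) : (dirac.{u} 𝕜 x).fiber x :=
  unit 𝕜 (Set.mem_singleton x)

theorem diracHom_ext {x : X} {ξ : PShv.{u} 𝕜 X} {h h' : dirac.{u} 𝕜 x ⟶ ξ}
    (hh : Ban.toCLM (appAt h x) (one 𝕜 x) = Ban.toCLM (appAt h' x) (one 𝕜 x)) : h = h' := by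
  refine charHom_ext fun y hy => ?_
  obtain rfl := Set.mem_singleton_iff.1 hy
  exact hh

open Classical in
theorem norm_single_le (ξ : PShv.{u} 𝕜 X) (x : X) (s : ξ.fiber x) (y : X) :
    ‖(Pi.single x s : ∀ y, ξ.fiber y) y‖ ≤ ‖s‖ := by
  by_cases h : y = x
  · subst h
    rw [Pi.single_eq_same]
  · rw [Pi.single_eq_of_ne h, norm_zero]
    exact norm_nonneg s

open Classical in
/-- The morphism from the Dirac presheaf at `x` defined by an element of the fiber over `x`. -/
def ofElement (ξ : PShv.{u} 𝕜 X) (x : X) (s : ξ.fiber x) : dirac.{u} 𝕜 x ⟶ ξ :=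
  homOfSection {x} (Pi.single x s) ‖s‖ (norm_single_le ξ x s)

theorem norm_ofElement_le (ξ : PShv.{u} 𝕜 X) (x : X) (s : ξ.fiber x) :
    ‖ofElement ξ x s‖ ≤ ‖s‖ := by
  classical
  exact norm_homOfSection_le (norm_nonneg s) (hv := norm_single_le ξ x s)

theorem ofElement_one (ξ : PShv.{u} 𝕜 X) (x : X) (s : ξ.fiber x) :
    Ban.toCLM (appAt (ofElement ξ x s) x) (one 𝕜 x) = s := by
  classical
  refine (homOfSection_unit (hv := norm_single_le ξ x s) (Set.mem_singleton x)).trans ?_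
  rw [Pi.single_eq_same]

/-- Naturality in the Yoneda correspondence: `δ x` represents the fiber at `x`. -/
theorem ofElement_comp {ξ ζ : PShv.{u} 𝕜 X} (x : X) (s : ξ.fiber x) (τ : ξ ⟶ ζ) :
    ofElement ξ x s ≫ τ = ofElement ζ x (Ban.toCLM (appAt τ x) s) := by
  refine diracHom_ext ?_
  rw [ofElement_one]
  exact congrArg (Ban.toCLM (appAt τ x)) (ofElement_one ξ x s)

theorem ofElement_dirac_one (x : X) : ofElement (dirac.{u} 𝕜 x) x (one 𝕜 x) = 𝟙 _ :=
  diracHom_ext (ofElement_one _ x _)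

/-- `ofElement` as a bounded linear map. -/
def ofElementL (ξ : PShv.{u} 𝕜 X) (x : X) : ξ.fiber x →L[𝕜] (dirac.{u} 𝕜 x ⟶ ξ) :=
  LinearMap.mkContinuous
    { toFun := ofElement ξ x
      map_add' := fun s t => diracHom_ext ((ofElement_one ξ x (s + t)).trans
        (congrArg₂ (· + ·) (ofElement_one ξ x s) (ofElement_one ξ x t)).symm)
      map_smul' := fun r s => diracHom_ext ((ofElement_one ξ x (r • s)).trans
        (congrArg (r • ·) (ofElement_one ξ x s)).symm) } 1
    (fun s => (norm_ofElement_le ξ x s).trans_eq (one_mul _).symm)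

theorem ofElementL_apply (ξ : PShv.{u} 𝕜 X) (x : X) (s : ξ.fiber x) :
    ofElementL ξ x s = ofElement ξ x s := rfl

/-- Evaluation at the element `1`, as a bounded linear map. -/
def evalOne (ξ : PShv.{u} 𝕜 X) (x : X) : (dirac.{u} 𝕜 x ⟶ ξ) →L[𝕜] ξ.fiber x :=
  LinearMap.mkContinuous
    { toFun := fun f => Ban.toCLM (appAt f x) (one 𝕜 x)
      map_add' := fun _ _ => rfl
      map_smul' := fun _ _ => rfl } 1
    (fun f => (norm_appAt_unit_le f _).trans_eq (one_mul _).symm)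

/-- The density formula `ξ ≅ ∑ x, ξ x ⊗ δ x`: a morphism `ξ ⟶ b` is a bounded family of maps from `ξ
x` to `b x`, and evaluation at `1` identifies `b x` isometrically with the morphisms `δ x ⟶ b`. -/
theorem isTensorSum_dirac (ξ : PShv.{u} 𝕜 X) :
    IsTensorSum ξ.fiber (fun x => dirac.{u} 𝕜 x) ξ (ofElementL ξ) where
  norm_le x := LinearMap.mkContinuous_norm_le _ zero_le_one _
  desc b φ C hC hφ := by
    have hn : ∀ x, ‖(evalOne b x).comp (φ x)‖ ≤ C := fun x =>
      (ContinuousLinearMap.opNorm_comp_le _ _).trans ((mul_le_of_le_one_left (norm_nonneg _)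
        (LinearMap.mkContinuous_norm_le _ zero_le_one _)).trans (hφ x))
    refine ⟨homMk (fun x => (evalOne b x).comp (φ x)) C hn, norm_le hC hn, fun x s => ?_⟩
    rw [ofElementL_apply, ofElement_comp]
    exact diracHom_ext (ofElement_one _ _ _)
  uniq b h h' hh := hom_ext fun x => ContinuousLinearMap.ext fun s => by
    have := hh x s
    rw [ofElementL_apply, ofElement_comp, ofElement_comp] at this
    have e := congrArg (fun k => Ban.toCLM (appAt k x) (one 𝕜 x)) this
    simp only [ofElement_one] at e
    exact e

end PShv

/-! ### Sums of tensors as functors on presheaves -/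

open PShv

/-- The functor `L`, with `e x : a x ⟶ L (δ x)`, is the functor `ξ ↦ ∑ x, ξ x ⊗ a x`. -/
structure IsTensorSumFunctor {𝕜 : Type} [RCLike 𝕜] {X : Type u} {A : Type v} [Category.{w} A]
    [HomNormed A] [BanachCategory 𝕜 A] (L : PShv.{u} 𝕜 X ⥤ A) (a : X → A)
    (e : ∀ x, a x ⟶ L.obj (dirac 𝕜 x)) : Prop where
  isBanachFunctor : IsBanachFunctor 𝕜 L
  norm_le : ∀ x, ‖e x‖ ≤ 1
  isTensorSum : ∀ ξ : PShv.{u} 𝕜 X, IsTensorSum ξ.fiber a (L.obj ξ) (fun x =>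
    (precompL 𝕜 (e x) (L.obj ξ)).comp ((isBanachFunctor.mapL (dirac 𝕜 x) ξ).comp (ofElementL ξ x)))

namespace IsTensorSumFunctor

variable {𝕜 : Type} [RCLike 𝕜] {X : Type u} {A : Type v}

section Comp

variable [Category.{w} A] {L : PShv.{u} 𝕜 X ⥤ A} {a : X → A} {e : ∀ x, a x ⟶ L.obj (dirac 𝕜 x)}

theorem comp_naturality {T : PShv.{u} 𝕜 X ⥤ A} {σ : ∀ ξ, L.obj ξ ⟶ T.obj ξ}
    (hσ : ∀ ⦃ξ ζ : PShv.{u} 𝕜 X⦄ (f : ξ ⟶ ζ), L.map f ≫ σ ζ = σ ξ ≫ T.map f)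
    (ξ : PShv.{u} 𝕜 X) (x : X) (s : ξ.fiber x) :
    (e x ≫ L.map (ofElement ξ x s)) ≫ σ ξ = (e x ≫ σ (dirac 𝕜 x)) ≫ T.map (ofElement ξ x s) := by
  rw [Category.assoc, hσ, Category.assoc]

theorem comp_map_ofElement_dirac_one (x : X) :
    e x ≫ L.map (ofElement (dirac 𝕜 x) x (one 𝕜 x)) = e x := by
  rw [ofElement_dirac_one, L.map_id, Category.comp_id]

theorem comp_map (ξ ζ : PShv.{u} 𝕜 X) (τ : ξ ⟶ ζ) (x : X) (s : ξ.fiber x) :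
    (e x ≫ L.map (ofElement ξ x s)) ≫ L.map τ =
      e x ≫ L.map (ofElement ζ x (Ban.toCLM (appAt τ x) s)) := by
  rw [Category.assoc, ← L.map_comp, ofElement_comp]

end Comp

section Natural

variable [Category.{w} A] [HomNormed A] [BanachCategory 𝕜 A] {L : PShv.{u} 𝕜 X ⥤ A} {a : X → A}
  {e : ∀ x, a x ⟶ L.obj (dirac 𝕜 x)}

theorem uniq (hL : IsTensorSumFunctor L a e) {ξ : PShv.{u} 𝕜 X} {b : A} {k k' : L.obj ξ ⟶ b}
    (h : ∀ x s, (e x ≫ L.map (ofElement ξ x s)) ≫ k = (e x ≫ L.map (ofElement ξ x s)) ≫ k') :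
    k = k' :=
  (hL.isTensorSum ξ).uniq b k k' h

theorem norm_le_of_comp (hL : IsTensorSumFunctor L a e) {ξ : PShv.{u} 𝕜 X} {b : A}
    {k : L.obj ξ ⟶ b} {C : ℝ} (hC : 0 ≤ C)
    (h : ∀ x s, ‖(e x ≫ L.map (ofElement ξ x s)) ≫ k‖ ≤ C * ‖s‖) : ‖k‖ ≤ C :=
  (hL.isTensorSum ξ).norm_le_of_comp hC h

theorem desc (hL : IsTensorSumFunctor L a e) {ξ : PShv.{u} 𝕜 X} {b : A}
    (φ : ∀ x, ξ.fiber x →L[𝕜] (a x ⟶ b)) {C : ℝ} (hC : 0 ≤ C) (hφ : ∀ x, ‖φ x‖ ≤ C) :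
    ∃ k : L.obj ξ ⟶ b, ‖k‖ ≤ C ∧ ∀ x s, (e x ≫ L.map (ofElement ξ x s)) ≫ k = φ x s :=
  (hL.isTensorSum ξ).desc b φ C hC hφ

theorem norm_comp_map_ofElement_le {T : PShv.{u} 𝕜 X ⥤ A} (hT : IsBanachFunctor 𝕜 T) {x : X}
    {b : A} {g : b ⟶ T.obj (dirac 𝕜 x)} {C : ℝ} (hC : 0 ≤ C) (hg : ‖g‖ ≤ C)
    (ξ : PShv.{u} 𝕜 X) (s : ξ.fiber x) : ‖g ≫ T.map (ofElement ξ x s)‖ ≤ C * ‖s‖ :=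
  (norm_comp_le (𝕜 := 𝕜) _ _).trans (mul_le_mul hg
    ((hT.norm_map_le _).trans (norm_ofElement_le ξ x s)) (norm_nonneg _) hC)

variable {T : PShv.{u} 𝕜 X ⥤ A}

/-- The generators of `L ξ` are `e x` followed by `L` of a morphism out of `δ x`, so naturality
moves the comparison to Dirac presheaves. -/
theorem natural_ext (hL : IsTensorSumFunctor L a e) {σ τ : ∀ ξ, L.obj ξ ⟶ T.obj ξ}
    (hσ : ∀ ⦃ξ ζ : PShv.{u} 𝕜 X⦄ (f : ξ ⟶ ζ), L.map f ≫ σ ζ = σ ξ ≫ T.map f)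
    (hτ : ∀ ⦃ξ ζ : PShv.{u} 𝕜 X⦄ (f : ξ ⟶ ζ), L.map f ≫ τ ζ = τ ξ ≫ T.map f)
    (h : ∀ x, e x ≫ σ (dirac 𝕜 x) = e x ≫ τ (dirac 𝕜 x)) (ξ : PShv.{u} 𝕜 X) : σ ξ = τ ξ :=
  hL.uniq fun x s => by rw [comp_naturality hσ, comp_naturality hτ, h]

theorem norm_natural_le (hL : IsTensorSumFunctor L a e) (hT : IsBanachFunctor 𝕜 T)
    {σ : ∀ ξ, L.obj ξ ⟶ T.obj ξ}
    (hσ : ∀ ⦃ξ ζ : PShv.{u} 𝕜 X⦄ (f : ξ ⟶ ζ), L.map f ≫ σ ζ = σ ξ ≫ T.map f) {C : ℝ}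
    (hC : 0 ≤ C) (h : ∀ x, ‖e x ≫ σ (dirac 𝕜 x)‖ ≤ C) (ξ : PShv.{u} 𝕜 X) : ‖σ ξ‖ ≤ C :=
  hL.norm_le_of_comp hC fun x s => by
    rw [comp_naturality hσ]
    exact norm_comp_map_ofElement_le hT hC (h x) ξ s

/-- With `natural_ext` and `norm_natural_le` this identifies the bounded natural transformations `L
⟶ T` isometrically with the bounded families `a x ⟶ T (δ x)`. The component at `ξ` is forced on
generators: it must send the generator of `s` to `g x` followed by `T (ofElement ξ x s)`. -/
theorem exists_natural (hL : IsTensorSumFunctor L a e) (hT : IsBanachFunctor 𝕜 T)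
    (g : ∀ x, a x ⟶ T.obj (dirac 𝕜 x)) {C : ℝ} (hC : 0 ≤ C) (hg : ∀ x, ‖g x‖ ≤ C) :
    ∃ σ : ∀ ξ, L.obj ξ ⟶ T.obj ξ, (∀ ξ, ‖σ ξ‖ ≤ C) ∧
      (∀ ⦃ξ ζ : PShv.{u} 𝕜 X⦄ (f : ξ ⟶ ζ), L.map f ≫ σ ζ = σ ξ ≫ T.map f) ∧
      ∀ x, e x ≫ σ (dirac 𝕜 x) = g x := by
  choose σ hn hσ using fun ξ : PShv.{u} 𝕜 X => hL.desc (b := T.obj ξ) (fun x =>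
    (precompL 𝕜 (g x) (T.obj ξ)).comp ((hT.mapL (dirac 𝕜 x) ξ).comp (ofElementL ξ x))) hC
    (fun x => ContinuousLinearMap.opNorm_le_bound _ hC fun s =>
      norm_comp_map_ofElement_le hT hC (hg x) ξ s)
  refine ⟨σ, hn, fun ξ ζ f => hL.uniq fun x s => ?_, fun x => ?_⟩
  · have h1 : (e x ≫ L.map (ofElement ξ x s)) ≫ σ ξ = g x ≫ T.map (ofElement ξ x s) := hσ ξ x s
    have h2 : (e x ≫ L.map (ofElement ζ x (Ban.toCLM (appAt f x) s))) ≫ σ ζ =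
        g x ≫ T.map (ofElement ζ x (Ban.toCLM (appAt f x) s)) := hσ ζ x _
    rw [← Category.assoc _ (L.map f), Category.assoc (e x), ← L.map_comp, ofElement_comp, h2,
      ← Category.assoc _ (σ ξ), h1, Category.assoc, ← T.map_comp, ofElement_comp]
  · have h1 : (e x ≫ L.map (ofElement (dirac 𝕜 x) x (one 𝕜 x))) ≫ σ (dirac 𝕜 x) =
        g x ≫ T.map (ofElement (dirac 𝕜 x) x (one 𝕜 x)) := hσ _ x _
    rwa [comp_map_ofElement_dirac_one, comp_map_ofElement_dirac_one] at h1

-- In the sum for `δ x` all summands vanish except the one at `x`, which is `𝕜 ⊗ a x ≅ a x`.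
open Classical in
theorem isIsometricIso (hL : IsTensorSumFunctor L a e) (x : X) :
    ∃ k : L.obj (dirac 𝕜 x) ⟶ a x, ‖k‖ ≤ 1 ∧ e x ≫ k = 𝟙 _ ∧ k ≫ e x = 𝟙 _ := by
  -- The inverse projects onto the summand at `x`: the identity there and zero at every other point.
  let v : ∀ y, a y ⟶ a x := fun y => if h : y = x then eqToHom (congrArg a h) else 0
  have hv : ∀ y, ‖v y‖ ≤ 1 := fun y => by
    by_cases h : y = x
    · subst h
      simp only [v, dif_pos, eqToHom_refl]
      exact norm_id_le (𝕜 := 𝕜) _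
    · simp only [v, dif_neg h, norm_zero]
      exact zero_le_one
  have hvx : v x = 𝟙 (a x) := dif_pos rfl
  obtain ⟨k, hk, hk'⟩ := hL.desc (ξ := dirac 𝕜 x) (fun y => fiberMap {x} y (v y)) zero_le_one
    fun y => (norm_fiberMap_le _ _ _).trans (hv y)
  have h1 : e x ≫ k = 𝟙 (a x) := by
    have := hk' x (one 𝕜 x)
    rwa [comp_map_ofElement_dirac_one, fiberMap_unit, hvx] at this
  refine ⟨k, hk, h1, hL.uniq fun y t => ?_⟩
  -- The other composite is checked on generators: at `x` the generator of `t` is a scalar multiple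
  -- of `e x`, and elsewhere `t = 0`.
  by_cases hy : y = x
  · subst hy
    have h2 : e y ≫ L.map (ofElement (dirac 𝕜 y) y t) = scalar t • e y := by
      conv_lhs => rw [eq_scalar_smul_unit (Set.mem_singleton y) t, ← ofElementL_apply, map_smul,
        hL.isBanachFunctor.map_smul, comp_smul, ofElementL_apply, comp_map_ofElement_dirac_one]
    rw [h2, smul_comp, smul_comp, ← Category.assoc, h1, Category.id_comp, Category.comp_id]
  · rw [eq_zero_of_notMem (fun h => hy (Set.mem_singleton_iff.1 h)) t, ← ofElementL_apply,
      map_zero, hL.isBanachFunctor.map_zero, comp_zero 𝕜, zero_comp 𝕜, zero_comp 𝕜]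

end Natural

end IsTensorSumFunctor

end

noncomputable section

open BanachCategory PShv

namespace IsTensorSumFunctor

variable {𝕜 : Type} [RCLike 𝕜] {X : Type u} {A : Type v} [Category.{u} A] [HomNormed A]
  [BanachCategory 𝕜 A] {L : PShv.{u} 𝕜 X ⥤ A} {a : X → A} {e : ∀ x, a x ⟶ L.obj (dirac 𝕜 x)}

/-! ### The right adjoint, and cocontinuity -/

/-- The presheaf `x ↦ A(a x, b)`. -/
def homPShv (𝕜 : Type) [RCLike 𝕜] [BanachCategory 𝕜 A] (a : X → A) (b : A) : PShv.{u} 𝕜 X :=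
  ofFibers fun x => ⟨a x ⟶ b⟩

/-- The transpose of a morphism `L ξ ⟶ b`. -/
def transpose (hL : IsTensorSumFunctor L a e) {ξ : PShv.{u} 𝕜 X} {b : A} (k : L.obj ξ ⟶ b) :
    ξ ⟶ homPShv 𝕜 a b :=
  PShv.homMk (fun x => (postcompL 𝕜 (a x) k).comp ((precompL 𝕜 (e x) (L.obj ξ)).comp
    ((hL.isBanachFunctor.mapL (dirac 𝕜 x) ξ).comp (ofElementL ξ x)))) ‖k‖ fun x =>
    (ContinuousLinearMap.opNorm_comp_le _ _).trans ((mul_le_of_le_one_right (norm_nonneg _)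
      ((hL.isTensorSum ξ).norm_le x)).trans (norm_postcompL_le _ _))

variable {ξ ζ : PShv.{u} 𝕜 X} {b : A}

theorem transpose_apply (hL : IsTensorSumFunctor L a e) (k : L.obj ξ ⟶ b) (x : X) (s : ξ.fiber x) :
    Ban.toCLM (appAt (hL.transpose k) x) s = (e x ≫ L.map (ofElement ξ x s)) ≫ k := rfl

theorem hom_homPShv_ext {g g' : ξ ⟶ homPShv 𝕜 a b}
    (h : ∀ x s, Ban.toCLM (appAt g x) s = Ban.toCLM (appAt g' x) s) : g = g' :=
  PShv.hom_ext fun x => ContinuousLinearMap.ext (h x)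

theorem transpose_injective (hL : IsTensorSumFunctor L a e) : Function.Injective (hL.transpose (ξ := ξ) (b := b)) :=
  fun _ _ h => hL.uniq fun x s =>
    DFunLike.congr_fun (congrArg (fun g => Ban.toCLM (appAt g x)) h) s

theorem norm_transpose_le (hL : IsTensorSumFunctor L a e) (k : L.obj ξ ⟶ b) : ‖hL.transpose k‖ ≤ ‖k‖ :=
  PShv.norm_le (norm_nonneg k) fun _ => (ContinuousLinearMap.opNorm_comp_le _ _).trans
    ((mul_le_of_le_one_right (norm_nonneg _) ((hL.isTensorSum ξ).norm_le _)).trans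
      (norm_postcompL_le _ _))

/-- Together with injectivity and `norm_transpose_le`, this makes transposition an isometric
bijection, so that `L` is left adjoint to `homPShv 𝕜 a`. -/
theorem exists_transpose_eq (hL : IsTensorSumFunctor L a e) (g : ξ ⟶ homPShv 𝕜 a b) :
    ∃ k : L.obj ξ ⟶ b, ‖k‖ ≤ ‖g‖ ∧ hL.transpose k = g := by
  obtain ⟨k, hk, hk'⟩ := hL.desc (b := b) (fun x => (Ban.toCLM (appAt g x) : _ →L[𝕜] (a x ⟶ b)))
    (norm_nonneg g) (fun x => FunCat.norm_app_le g _)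
  exact ⟨k, hk, hom_homPShv_ext hk'⟩

theorem transpose_add (hL : IsTensorSumFunctor L a e) (k k' : L.obj ξ ⟶ b) :
    hL.transpose (k + k') = hL.transpose k + hL.transpose k' :=
  hom_homPShv_ext fun _ _ => comp_add (𝕜 := 𝕜) _ k k'

theorem transpose_smul (hL : IsTensorSumFunctor L a e) (r : 𝕜) (k : L.obj ξ ⟶ b) :
    hL.transpose (r • k) = r • hL.transpose k :=
  hom_homPShv_ext fun _ _ => comp_smul r _ k

theorem transpose_comp (hL : IsTensorSumFunctor L a e) (f : ξ ⟶ ζ) (k : L.obj ζ ⟶ b) :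
    hL.transpose (L.map f ≫ k) = f ≫ hL.transpose k :=
  hom_homPShv_ext fun x s => by
    rw [transpose_apply, ← Category.assoc, comp_map]
    rfl

/-- Left adjoints preserve colimits: a cocone under `L D` is transposed to one under `D`, factored
through `c`, and transposed back, all with the bound `C` intact. -/
theorem isCocontinuous (hL : IsTensorSumFunctor L a e) : IsCocontinuous 𝕜 L where
  isBanachFunctor := hL.isBanachFunctor
  preserves J _ _ _ W D _ _ c inj hc := by
    refine ⟨⟨fun j s t => ?_, fun j r s => ?_, fun j s => ?_, fun f s => ?_⟩,
      fun b φ C hC hφ => ?_, fun b h h' hh => ?_⟩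
    · rw [hc.isCocone.map_add]
      exact hL.isBanachFunctor.map_add _ _
    · rw [hc.isCocone.map_smul]
      exact hL.isBanachFunctor.map_smul _ _
    · exact (hL.isBanachFunctor.norm_map_le _).trans (hc.isCocone.norm_le j s)
    · rw [hc.isCocone.natural]
      exact L.map_comp _ _
    · have hψ : IsCocone W D (homPShv 𝕜 a b) C (fun j s => hL.transpose (φ j s)) :=
        { map_add := fun j s t => (congrArg hL.transpose (hφ.map_add j s t)).trans
            (hL.transpose_add _ _)
          map_smul := fun j r s => (congrArg hL.transpose (hφ.map_smul j r s)).trans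
            (hL.transpose_smul _ _)
          norm_le := fun j s => (hL.norm_transpose_le _).trans (hφ.norm_le j s)
          natural := fun f s => (congrArg hL.transpose (hφ.natural f s)).trans
            (hL.transpose_comp _ _) }
      obtain ⟨g, hg, hg'⟩ := hc.desc _ _ C hC hψ
      obtain ⟨k, hk, rfl⟩ := hL.exists_transpose_eq g
      refine ⟨k, hk.trans hg, fun j s => hL.transpose_injective ?_⟩
      rw [transpose_comp]
      exact hg' j s
    · refine hL.transpose_injective (hc.uniq _ _ _ fun j s => ?_)
      rw [← transpose_comp, ← transpose_comp]
      exact congrArg hL.transpose (hh j s)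

theorem isSumOfTensors (hL : IsTensorSumFunctor L a e) (hA : IsBanachTwoSpace 𝕜 A) : IsSumOfTensors L a := by
  choose t ten ht using fun (ξ : PShv.{u} 𝕜 X) x => hA.exists_isTensor (ξ.fiber x) (a x)
  choose j hj hj' using fun ξ : PShv.{u} 𝕜 X => (hL.isTensorSum ξ).exists_isCoproduct (ht ξ)
  refine ⟨t, ten, j, ht, hj, fun ξ ζ τ x s => ?_⟩
  rw [← Category.assoc, hj', hj']
  exact comp_map ξ ζ τ x s

end IsTensorSumFunctor

/-! ### The integral functor, and the comparison of cocontinuous functors with cosheaves. -/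

section

variable {𝕜 : Type} [RCLike 𝕜] {X : Type u} {A : Type v} [Category.{u} A] [HomNormed A]
  [BanachCategory 𝕜 A]

/-- Sums are chosen for each presheaf and made functorial by their universal property, which also
forces linearity in `τ` and the norm bound. -/
theorem IsBanachTwoSpace.exists_isTensorSumFunctor (hA : IsBanachTwoSpace 𝕜 A) (a : X → A) :
    ∃ (L : PShv.{u} 𝕜 X ⥤ A) (e : ∀ x, a x ⟶ L.obj (dirac 𝕜 x)), IsTensorSumFunctor L a e := by
  choose c inj hc using fun ξ : PShv.{u} 𝕜 X => hA.exists_isTensorSum ξ.fiber a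
  have hex : ∀ (ξ ζ : PShv.{u} 𝕜 X) (τ : ξ ⟶ ζ), ∃ k : c ξ ⟶ c ζ, ‖k‖ ≤ ‖τ‖ ∧
      ∀ x s, inj ξ x s ≫ k = inj ζ x (Ban.toCLM (appAt τ x) s) := fun ξ ζ τ =>
    (hc ξ).desc (c ζ) (fun x => (inj ζ x).comp (Ban.toCLM (appAt τ x))) ‖τ‖ (norm_nonneg τ)
      fun x => (ContinuousLinearMap.opNorm_comp_le _ _).trans
        ((mul_le_of_le_one_left (norm_nonneg _) ((hc ζ).norm_le x)).trans (FunCat.norm_app_le τ _))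
  choose m hm hm' using hex
  let L : PShv.{u} 𝕜 X ⥤ A :=
    { obj := c
      map := fun {ξ ζ} τ => m ξ ζ τ
      map_id := fun ξ => (hc ξ).uniq _ _ _ fun x s => (hm' ξ ξ _ x s).trans (Category.comp_id _).symm
      map_comp := fun {ξ ζ θ} σ τ => (hc ξ).uniq _ _ _ fun x s => by
        rw [← Category.assoc, hm', hm', hm']
        rfl }
  have hL : IsBanachFunctor 𝕜 L :=
    { map_add := fun {ξ ζ} σ τ => (hc ξ).uniq _ _ _ fun x s => by
        refine (hm' ξ ζ _ x s).trans (Eq.trans ?_ (comp_add (𝕜 := 𝕜) _ _ _).symm)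
        refine ((inj ζ x).map_add _ _).trans ?_
        exact congrArg₂ (· + ·) (hm' ξ ζ σ x s).symm (hm' ξ ζ τ x s).symm
      map_smul := fun {ξ ζ} r τ => (hc ξ).uniq _ _ _ fun x s => by
        refine (hm' ξ ζ _ x s).trans (Eq.trans ?_ (comp_smul r _ _).symm)
        refine ((inj ζ x).map_smul r _).trans ?_
        exact congrArg (r • ·) (hm' ξ ζ τ x s).symm
      norm_map_le := fun {ξ ζ} τ => hm ξ ζ τ }
  -- The map `e x` is the injection at `1` in the fiber of `δ x` over `x`. Applying `L` to
  -- `ofElement ξ x s`, which sends `1` to `s`, recovers the whole injection into the sum for `ξ`.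
  refine ⟨L, fun x => inj (dirac 𝕜 x) x (one 𝕜 x), hL, fun x => ?_, fun ξ => ?_⟩
  · exact ((hc _).norm_inj_apply_le x _).trans_eq (norm_unit _)
  · have h : (fun x => (precompL 𝕜 (inj (dirac 𝕜 x) x (one 𝕜 x)) (L.obj ξ)).comp
        ((hL.mapL (dirac 𝕜 x) ξ).comp (ofElementL ξ x))) = inj ξ := by
      refine funext fun x => ContinuousLinearMap.ext fun s => ?_
      exact (hm' _ _ (ofElement ξ x s) x (one 𝕜 x)).trans
        (congrArg (inj ξ x) (ofElement_one ξ x s))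
    exact (congrArg (IsTensorSum ξ.fiber a (c ξ)) h).mpr (hc ξ)

/-- A cocontinuous functor on presheaves is determined by its values on the Dirac presheaves. -/
theorem IsCocontinuous.isTensorSumFunctor {T : PShv.{u} 𝕜 X ⥤ A} (hT : IsCocontinuous 𝕜 T) :
    IsTensorSumFunctor T (fun x => T.obj (dirac 𝕜 x)) (fun _ => 𝟙 _) where
  isBanachFunctor := hT.isBanachFunctor
  norm_le _ := norm_id_le (𝕜 := 𝕜) _
  isTensorSum ξ := by
    have h : (fun x => (precompL 𝕜 (𝟙 (T.obj (dirac 𝕜 x))) (T.obj ξ)).comp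
        ((hT.isBanachFunctor.mapL (dirac 𝕜 x) ξ).comp (ofElementL ξ x))) =
        fun x => (hT.isBanachFunctor.mapL (dirac 𝕜 x) ξ).comp (ofElementL ξ x) :=
      funext fun x => ContinuousLinearMap.ext fun s => Category.id_comp _
    exact (congrArg (IsTensorSum ξ.fiber _ (T.obj ξ)) h).mpr (hT.isTensorSum (isTensorSum_dirac ξ))

theorem IsCocontinuous.isCosheaf {T : PShv.{u} 𝕜 X ⥤ A} (hT : IsCocontinuous 𝕜 T) :
    IsCosheaf (universalCosheaf.{u} 𝕜 X ⋙ T) where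
  isContractive :=
    IsBanachFunctor.isContractive_comp (isContractive_universalCosheaf 𝕜 X) T hT.isBanachFunctor
  isSigmaAdditive E 𝓔 h𝓔 :=
    hT.isCoproduct (isCosheaf_universalCosheaf.isSigmaAdditive E 𝓔 h𝓔)

variable [Countable X]

/-- A transformation `T ⟶ S` and a transformation `T χ ⟶ S χ` are both the same thing as a bounded
family `T (δ x) ⟶ S (δ x)`, since `χ {x} = δ x`. -/
theorem isIsometricFF_precomp_universalCosheaf
    (h : ∀ T : PShv.{u} 𝕜 X ⥤ A, IsCocontinuous 𝕜 T → IsCosheaf (universalCosheaf.{u} 𝕜 X ⋙ T)) :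
    IsIsometricFF 𝕜 (FunCat.precomp (universalCosheaf.{u} 𝕜 X) h :
      CocontinuousFun 𝕜 (PShv.{u} 𝕜 X) A ⥤ CoShv 𝕜 X A) where
  isBanachFunctor := FunCat.isBanachFunctor_precomp _ _
  norm_map {T S} τ := le_antisymm ((FunCat.isBanachFunctor_precomp _ h).norm_map_le τ)
    (FunCat.norm_le (norm_nonneg _) (T.property.isTensorSumFunctor.norm_natural_le
      S.property.isBanachFunctor (fun _ _ f => FunCat.naturality τ f) (norm_nonneg _) fun x => by
        rw [Category.id_comp]
        exact FunCat.norm_app_le ((FunCat.precomp (universalCosheaf.{u} 𝕜 X) h).map τ) {x}))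
  surjective T S τ := by
    obtain ⟨σ, hn, hσ, e⟩ := T.property.isTensorSumFunctor.exists_natural
      S.property.isBanachFunctor (fun x => FunCat.app τ {x}) (norm_nonneg τ)
      (fun x => FunCat.norm_app_le τ {x})
    refine ⟨FunCat.homMk σ ‖τ‖ hn hσ, FunCat.hom_ext ?_⟩
    exact (h T.obj T.property).natural_ext (G := universalCosheaf.{u} 𝕜 X ⋙ S.obj)
      (fun _ _ f => hσ _) (fun _ _ f => FunCat.naturality τ f)
      (fun x => (Category.id_comp _).symm.trans (e x))

/-- A cosheaf is isometrically isomorphic to the composite of `χ` with its integral. -/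
theorem IsTensorSumFunctor.exists_iso {μ : CoShv 𝕜 X A} {L : PShv.{u} 𝕜 X ⥤ A}
    {e : ∀ x, μ.obj.obj {x} ⟶ L.obj (dirac 𝕜 x)}
    (hL : IsTensorSumFunctor L (fun x => μ.obj.obj {x}) e) :
    ∃ (η : ∀ E, μ.obj.obj E ⟶ L.obj ((universalCosheaf.{u} 𝕜 X).obj E))
      (θ : ∀ E, L.obj ((universalCosheaf.{u} 𝕜 X).obj E) ⟶ μ.obj.obj E),
      (∀ E, ‖η E‖ ≤ 1) ∧ (∀ E, ‖θ E‖ ≤ 1) ∧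
      (∀ ⦃E F : Set X⦄ (f : E ⟶ F),
        μ.obj.map f ≫ η F = η E ≫ (universalCosheaf.{u} 𝕜 X ⋙ L).map f) ∧
      (∀ ⦃E F : Set X⦄ (f : E ⟶ F),
        (universalCosheaf.{u} 𝕜 X ⋙ L).map f ≫ θ F = θ E ≫ μ.obj.map f) ∧
      (∀ E, η E ≫ θ E = 𝟙 _) ∧ (∀ E, θ E ≫ η E = 𝟙 _) ∧ ∀ x, η {x} = e x := by
  have hν : IsCosheaf (universalCosheaf.{u} 𝕜 X ⋙ L) := hL.isCocontinuous.isCosheaf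
  choose k hk h1 h2 using hL.isIsometricIso
  obtain ⟨η, hη, nη, eη⟩ := IsCosheaf.exists_natural 𝕜 μ.property hν.isContractive e
    zero_le_one hL.norm_le
  obtain ⟨θ, hθ, nθ, eθ⟩ := IsCosheaf.exists_natural 𝕜 hν μ.property.isContractive k
    zero_le_one hk
  refine ⟨η, θ, hη, hθ, nη, nθ, ?_, ?_, eη⟩
  · refine μ.property.natural_ext (G := μ.obj) (σ := fun E => η E ≫ θ E) (τ := fun E => 𝟙 _)
      (fun E F f => ?_) (fun E F f => ?_) (fun x => ?_)
    · exact (Category.assoc _ _ _).symm.trans ((congrArg (· ≫ θ F) (nη f)).trans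
        ((Category.assoc _ _ _).trans ((congrArg (η E ≫ ·) (nθ f)).trans
          (Category.assoc _ _ _).symm)))
    · exact (Category.comp_id _).trans (Category.id_comp _).symm
    · rw [eη, eθ]
      exact h1 x
  · refine hν.natural_ext (G := universalCosheaf.{u} 𝕜 X ⋙ L) (σ := fun E => θ E ≫ η E)
      (τ := fun E => 𝟙 _) (fun E F f => ?_) (fun E F f => ?_) (fun x => ?_)
    · exact (Category.assoc _ _ _).symm.trans ((congrArg (· ≫ η F) (nθ f)).trans
        ((Category.assoc _ _ _).trans ((congrArg (θ E ≫ ·) (nη f)).trans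
          (Category.assoc _ _ _).symm)))
    · exact (Category.comp_id _).trans (Category.id_comp _).symm
    · rw [eη, eθ]
      exact h2 x

theorem isBanachEquivalence_precomp_universalCosheaf (hA : IsBanachTwoSpace 𝕜 A)
    (h : ∀ T : PShv.{u} 𝕜 X ⥤ A, IsCocontinuous 𝕜 T → IsCosheaf (universalCosheaf.{u} 𝕜 X ⋙ T)) :
    IsBanachEquivalence 𝕜 (FunCat.precomp (universalCosheaf.{u} 𝕜 X) h :
      CocontinuousFun 𝕜 (PShv.{u} 𝕜 X) A ⥤ CoShv 𝕜 X A) where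
  isIsometricFF := isIsometricFF_precomp_universalCosheaf h
  essSurj μ := by
    obtain ⟨L, e, hL⟩ := hA.exists_isTensorSumFunctor (fun x => μ.obj.obj {x})
    obtain ⟨η, θ, hη, hθ, nη, nθ, h1, h2, -⟩ := hL.exists_iso
    exact ⟨⟨L, hL.isCocontinuous⟩, FunCat.homMk θ 1 hθ nθ, FunCat.norm_le zero_le_one hθ,
      FunCat.homMk η 1 hη nη, FunCat.norm_le zero_le_one hη, FunCat.hom_ext h2,
      FunCat.hom_ext h1⟩

/-- Transformations `L ⟶ T` correspond through `e`, and transformations `μ ⟶ T χ` through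
restriction to atoms, to bounded families `μ {x} ⟶ T (δ x)`. As `η` is `e` on atoms, composition
with it respects both identifications. -/
theorem IsTensorSumFunctor.isLeftKanExtension {μ : CoShv 𝕜 X A} {L : PShv.{u} 𝕜 X ⥤ A}
    {e : ∀ x, μ.obj.obj {x} ⟶ L.obj (dirac 𝕜 x)}
    (hL : IsTensorSumFunctor L (fun x => μ.obj.obj {x}) e)
    (η : μ.toPrecosheaf ⟶ (restrictAlong (universalCosheaf.{u} 𝕜 X)
      (isContractive_universalCosheaf 𝕜 X)).obj ⟨L, hL.isBanachFunctor⟩)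
    (hη : ‖η‖ ≤ 1) (eη : ∀ x, FunCat.app η {x} = e x) :
    IsLeftKanExtension (universalCosheaf.{u} 𝕜 X) (isContractive_universalCosheaf 𝕜 X)
      μ.toPrecosheaf ⟨L, hL.isBanachFunctor⟩ η where
  norm_le := hη
  bijective T := by
    refine ⟨fun σ τ h => FunCat.hom_ext (hL.natural_ext (fun _ _ f => FunCat.naturality σ f)
      (fun _ _ f => FunCat.naturality τ f) fun x => ?_), fun τ => ?_⟩
    · rw [← eη]
      exact congrArg (fun ρ => FunCat.app ρ {x}) h
    · obtain ⟨σ, hn, hσ, e'⟩ := hL.exists_natural T.property (fun x => FunCat.app τ {x})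
        (norm_nonneg τ) (fun x => FunCat.norm_app_le τ {x})
      refine ⟨FunCat.homMk σ ‖τ‖ hn hσ, FunCat.hom_ext ?_⟩
      refine μ.property.natural_ext (G := universalCosheaf.{u} 𝕜 X ⋙ T.obj)
        (fun _ _ f => FunCat.naturality (η ≫ (restrictAlong (universalCosheaf.{u} 𝕜 X)
          (isContractive_universalCosheaf 𝕜 X)).map (FunCat.homMk σ ‖τ‖ hn hσ)) f)
        (fun _ _ f => FunCat.naturality τ f) fun x => ?_
      refine Eq.trans ?_ (e' x)
      exact congrArg (· ≫ σ (dirac 𝕜 x)) (eη x)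
  isometric T σ := by
    -- One inequality is contractivity of `η` and of restriction; the other holds because the norm
    -- of `σ` is bounded by the norms of `e x ≫ σ (δ x)`, which are components of the composite at
    -- atoms.
    refine le_antisymm (norm_comp_le_of_le 𝕜 hη
      ((FunCat.isBanachFunctor_precomp _ _).norm_map_le σ)) ?_
    refine FunCat.norm_le (norm_nonneg _) (hL.norm_natural_le T.property
      (fun _ _ f => FunCat.naturality σ f) (norm_nonneg _) fun x => ?_)
    rw [← eη]
    exact FunCat.norm_app_le (η ≫ (restrictAlong (universalCosheaf.{u} 𝕜 X)
      (isContractive_universalCosheaf 𝕜 X)).map σ) {x}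

end

end

theorem mainTheorem8 (𝕜 : Type) [RCLike 𝕜] (X : Type u) [Countable X]
    (A : Type v) [Category.{u} A] [HomNormed A] [BanachCategory 𝕜 A]
    (hA : IsBanachTwoSpace 𝕜 A) :
    -- restriction to atoms
    (IsIsometricFF 𝕜 (restrictToAtoms 𝕜 X A) ∧
      Function.Surjective (restrictToAtoms 𝕜 X A).obj) ∧
    -- presheaves and bundles
    (IsIsometricFF 𝕜 (bundleToPShv.{u} 𝕜 X) ∧
      Function.Bijective (bundleToPShv.{u} 𝕜 X).obj) ∧
    IsBanachTwoSpace 𝕜 (PShv.{u} 𝕜 X) ∧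
    -- cosheaves and cocontinuous functors
    IsCosheaf (universalCosheaf.{u} 𝕜 X) ∧
    (∃ h : ∀ T : PShv.{u} 𝕜 X ⥤ A, IsCocontinuous 𝕜 T → IsCosheaf (universalCosheaf.{u} 𝕜 X ⋙ T),
      IsBanachEquivalence 𝕜
        (FunCat.precomp (universalCosheaf.{u} 𝕜 X) h :
          CocontinuousFun 𝕜 (PShv.{u} 𝕜 X) A ⥤ CoShv 𝕜 X A)) ∧
    -- the integral functor of a cosheaf
    (∀ μ : CoShv 𝕜 X A, ∃ (L : BanachFun 𝕜 (PShv.{u} 𝕜 X) A)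
      (η : μ.toPrecosheaf ⟶
        (restrictAlong (universalCosheaf.{u} 𝕜 X) (isContractive_universalCosheaf 𝕜 X)).obj L),
      IsLeftKanExtension (universalCosheaf.{u} 𝕜 X) (isContractive_universalCosheaf 𝕜 X)
        μ.toPrecosheaf L η ∧
      IsIsometricIso η ∧
      IsCocontinuous 𝕜 L.obj ∧
      IsSumOfTensors L.obj (fun x => μ.obj.obj {x})) := by
  refine ⟨⟨isIsometricFF_restrictToAtoms 𝕜, surjective_restrictToAtoms_obj hA⟩,
    ⟨isIsometricFF_bundleToPShv, bijective_bundleToPShv_obj⟩, PShv.isBanachTwoSpace,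
    PShv.isCosheaf_universalCosheaf, ⟨fun T hT => hT.isCosheaf,
      isBanachEquivalence_precomp_universalCosheaf hA _⟩, fun μ => ?_⟩
  obtain ⟨L, e, hL⟩ := hA.exists_isTensorSumFunctor (fun x => μ.obj.obj {x})
  obtain ⟨η, θ, hη, hθ, nη, nθ, h1, h2, eη⟩ := hL.exists_iso
  exact ⟨⟨L, hL.isBanachFunctor⟩, FunCat.homMk η 1 hη nη,
    hL.isLeftKanExtension _ (FunCat.norm_le zero_le_one hη) eη,
    ⟨FunCat.norm_le zero_le_one hη, FunCat.homMk θ 1 hθ nθ, FunCat.norm_le zero_le_one hθ,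
      FunCat.hom_ext h1, FunCat.hom_ext h2⟩,
    hL.isCocontinuous, hL.isSumOfTensors hA⟩
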